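/- Let $p,m\ge 1$ be integers, let $\mathbf n=(n_1,\dots,n_p)\in\mathbb Z_+^p$ (where $\mathbb Z_+=\{0,1,2,\dots\}$), and let $f:\mathbb R^p\to\mathbb R$ be $2m$-times continuously differentiable, with partial derivatives $f^{(\boldsymbol\alpha)}$, $\boldsymbol\alpha\in\mathbb Z_+^p$. Notation. For vectors, $\le$ and products are coordinatewise; $\mathbf 1=(1,\dots,1)$, $\mathbf 0=(0,\dots,0)$, $\|\boldsymbol\alpha\|=\alpha_1+\dots+\alpha_p$, $\boldsymbol\alpha!=\alpha_1!\cdots\alpha_p!$, $\mathbf x^{\boldsymbol\alpha}=x_1^{\alpha_1}\cdots x_p^{\alpha_p}$, $|\boldsymbol\beta|=(|\beta_1|,\dots,|\beta_p|)$. A sum $\sum_{\mathbf i=\mathbf a}^{\mathbf b}$ is over all integer vectors $\mathbf i$ with $\mathbf a\le\mathbf i\le\mathbf b$; an empty sum is $0$. For $\mathbf u,\mathbf v\in\mathbb R^p$, $\int_{\mathbf u}^{\mathbf v}d\mathbf x\,h(\mathbf x)$ is the Lebesgue integral of $h$ over $\prod_r[\min(u_r,v_r),\max(u_r,v_r)]$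 multiplied by $(-1)^{\#\{r:\,u_r>v_r\}}$, and $\int_{\mathbf u}^{\mathbf v}:=\int_{\mathbf u}^{\mathbf v}d\mathbf x\,f(\mathbf x)$. For integers $j\ge1$ let $$\gamma_{m,j}=(-1)^{j-1}\frac2j\binom{2m}{m+j}\Big/\binom{2m}{m},\qquad \tau_{m,j}=\sum_{\beta=0}^{\lfloor (m-j)/2\rfloor}\gamma_{m,j+2\beta}\quad(1\le j\le m),$$ and $\gamma_{m,\mathbf j}=\prod_{r=1}^p\gamma_{m,j_r}$, $\tau_{m,\mathbf j}=\prod_{r=1}^p\tau_{m,j_r}$. Then the following hold. (i) $\displaystyle\sum_{\mathbf k=\mathbf 0}^{\mathbf n-\mathbf 1}f(\mathbf k)=A_m-R_m$, where $$\begin{aligned}A_m&:=\sum_{\mathbf j=\mathbf 1}^{m\mathbf 1}\gamma_{m,\mathbf j}\sum_{\mathbf i=\mathbf 0}^{\mathbf j-\mathbf 1}\int_{\mathbf i-\mathbf j/2}^{\mathbf n-\mathbf 1+\mathbf j/2-\mathbf i}=\sum_{\mathbf j=\mathbf 1}^{m\mathbf 1}\gamma_{m,\mathbf j}\sum_{\mathbf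 i=\mathbf 0}^{\mathbf j-\mathbf 1}\int_{-\mathbf 1+\mathbf j/2-\mathbf i}^{\mathbf n-\mathbf 1+\mathbf j/2-\mathbf i}\\ &=\sum_{\boldsymbol\beta=(1-m)\mathbf 1}^{(m-1)\mathbf 1}\tau_{m,\mathbf 1+|\boldsymbol\beta|}\int_{\boldsymbol\beta/2-\mathbf 1/2}^{\mathbf n-\mathbf 1/2-\boldsymbol\beta/2}=\sum_{\boldsymbol\beta=(1-m)\mathbf 1}^{(m-1)\mathbf 1}\tau_{m,\mathbf 1+|\boldsymbol\beta|}\int_{-\mathbf 1/2-\boldsymbol\beta/2}^{\mathbf n-\mathbf 1/2-\boldsymbol\beta/2}\\ &=\sum_{\boldsymbol\alpha=\mathbf 0}^{(m-1)\mathbf 1}\tau_{m,\mathbf 1+\boldsymbol\alpha}\sum_{\boldsymbol\beta\in\mathbb Z^p:\,|\boldsymbol\beta|=\boldsymbol\alpha}\int_{\boldsymbol\beta/2-\mathbf 1/2}^{\mathbf n-\mathbf 1/2-\boldsymbol\beta/2}=\sum_{\boldsymbol\alpha=\mathbf 0}^{(m-1)\mathbf 1}\tau_{m,\mathbf 1+\boldsymbol\alpha}\sum_{\boldsymbol\beta\in\mathbb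 Z^p:\,|\boldsymbol\beta|=\boldsymbol\alpha}\int_{-\mathbf 1/2-\boldsymbol\beta/2}^{\mathbf n-\mathbf 1/2-\boldsymbol\beta/2}\end{aligned}$$ and $$R_m:=\frac{m}{2^{2m+p-1}}\sum_{\|\boldsymbol\alpha\|=2m}\frac1{\boldsymbol\alpha!}\int_0^1ds\,(1-s)^{2m-1}\int_{-\mathbf 1}^{\mathbf 1}d\mathbf v\,\mathbf v^{\boldsymbol\alpha}\sum_{\mathbf j=\mathbf 1}^{m\mathbf 1}\gamma_{m,\mathbf j}\,\mathbf j^{\boldsymbol\alpha+\mathbf 1}\sum_{\mathbf k=\mathbf 0}^{\mathbf n-\mathbf 1}f^{(\boldsymbol\alpha)}(\mathbf k+s\,\mathbf j\mathbf v/2).$$ Moreover, $\tau_{m,j}=\sum_{\beta=0}^\infty\gamma_{m,j+2\beta}$ for $1\le j\le m$. (ii) The coefficients of the integrals in each of these expressions for $A_m$ sum to $1$: $$\sum_{\mathbf j=\mathbf 1}^{m\mathbf 1}\gamma_{m,\mathbf j}\sum_{\mathbf i=\mathbf 0}^{\mathbf j-\mathbf 1}1=\sum_{\mathbf j=\mathbf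 1}^{m\mathbf 1}\gamma_{m,\mathbf j}\,\mathbf j^{\mathbf 1}=\sum_{\boldsymbol\beta=(1-m)\mathbf 1}^{(m-1)\mathbf 1}\tau_{m,\mathbf 1+|\boldsymbol\beta|}=\sum_{\boldsymbol\alpha=\mathbf 0}^{(m-1)\mathbf 1}\tau_{m,\mathbf 1+\boldsymbol\alpha}\sum_{\boldsymbol\beta:\,|\boldsymbol\beta|=\boldsymbol\alpha}1=1.$$ (iii) If $M_{2m}$ is a real number such that $\big|\sum_{\mathbf k=\mathbf 0}^{\mathbf n-\mathbf 1}f^{(\boldsymbol\alpha)}(\mathbf k+\mathbf u)\big|\le M_{2m}$ for all $\boldsymbol\alpha\in\mathbb Z_+^p$ with $\|\boldsymbol\alpha\|=2m$ and all $\mathbf u\in(-m/2,m/2]^p$, then $$|R_m|\le\frac{M_{2m}}{2^{2m}}\sum_{\|\boldsymbol\alpha\|=2m}\frac1{(\boldsymbol\alpha+\mathbf 1)!}\sum_{\mathbf j=\mathbf 1}^{m\mathbf 1}|\gamma_{m,\mathbf j}|\,\mathbf j^{\boldsymbol\alpha+\mathbf 1}\le M_{2m}\,\frac{1.0331\,(\pi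 m)^{(p+1)/2}}{(2m+1)!}\,(\kappa pm)^{2m},$$ where $\kappa:=\sqrt{\Lambda_*/4}=0.27754\ldots$ and $\Lambda_*:=\max_{0<t<1}\Lambda(t)=0.3081\ldots$ (the maximum being attained) with $\Lambda(t):=(1-t)^{t-1}(1+t)^{-1-t}t^2$. If $m\ge2$, the factor $1.0331$ can be replaced by $1.001$. -/

import Mathlib

namespace AltSum

noncomputable section

/-- The multi-indices `k` with `0 ≤ k ≤ n - 1` coordinatewise, i.e. `0 ≤ k r < n r` for every `r`
(there are none if some `n r = 0`). -/
def below {p : ℕ} (n : Fin p → ℕ) : Finset (Fin p → ℕ) :=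
  Fintype.piFinset fun r => Finset.range (n r)

/-- The multi-indices `j` with `1 ≤ j r ≤ m` for every `r`. -/
def upTo (p m : ℕ) : Finset (Fin p → ℕ) :=
  Finset.Icc (fun _ => 1) (fun _ => m)

/-- The integer vectors `β` with `1 - m ≤ β r ≤ m - 1` for every `r`. -/
def symBox (p m : ℕ) : Finset (Fin p → ℤ) :=
  Finset.Icc (fun _ => 1 - (m : ℤ)) (fun _ => (m : ℤ) - 1)

/-- The coordinatewise absolute value of an integer vector. -/
def absVec {p : ℕ} (β : Fin p → ℤ) : Fin p → ℕ := fun r => (β r).natAbs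

/-- All integer vectors `β` whose coordinatewise absolute value is `α`. -/
def signed {p : ℕ} (α : Fin p → ℕ) : Finset (Fin p → ℤ) :=
  (Finset.Icc (fun r => -(α r : ℤ)) (fun r => (α r : ℤ))).filter fun β => absVec β = α

/-- The multi-indices `α` with `α 1 + ⋯ + α p = d`. -/
def ofDegree (p d : ℕ) : Finset (Fin p → ℕ) :=
  Finset.piAntidiag Finset.univ d

/-- The first-order partial derivative in the coordinate `r`. -/
def partialDeriv {p : ℕ} (r : Fin p) (f : (Fin p → ℝ) → ℝ) : (Fin p → ℝ) → ℝ :=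
  fun x => lineDeriv ℝ f x (Pi.single r 1)

/-- The iterated partial derivative `∂₁^{α₁} ⋯ ∂ₚ^{αₚ} f`. -/
def multiDeriv {p : ℕ} (α : Fin p → ℕ) (f : (Fin p → ℝ) → ℝ) : (Fin p → ℝ) → ℝ :=
  (List.finRange p).foldr (fun r g => (partialDeriv r)^[α r] g) f

/-- The oriented integral of `h` from the corner `u` to the corner `v`: the Lebesgue integral over
the box `[u ∧ v, u ∨ v]` times `-1` for each coordinate with `u r > v r`. -/
def boxInt {p : ℕ} (u v : Fin p → ℝ) (h : (Fin p → ℝ) → ℝ) : ℝ :=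
  (-1) ^ (Finset.univ.filter fun r => v r < u r).card * ∫ x in Set.Icc (u ⊓ v) (u ⊔ v), h x

/-- The coefficient `γ_{m,j}`, for `j ≥ 1`. -/
def gam (m j : ℕ) : ℝ :=
  (-1) ^ (j - 1) * (2 / (j : ℝ)) * ((2 * m).choose (m + j) : ℝ) / ((2 * m).choose m : ℝ)

/-- The product coefficient `γ_{m,j}` for a multi-index `j`. -/
def gamVec {p : ℕ} (m : ℕ) (j : Fin p → ℕ) : ℝ := ∏ r, gam m (j r)

/-- The coefficient `τ_{m,j}`, for `1 ≤ j ≤ m`: the sum of `γ_{m,j+2β}` over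
`β = 0, …, ⌊(m - j)/2⌋`. -/
def tau (m j : ℕ) : ℝ := ∑ β ∈ Finset.range ((m - j) / 2 + 1), gam m (j + 2 * β)

/-- The product coefficient `τ_{m,j}` for a multi-index `j`. -/
def tauVec {p : ℕ} (m : ℕ) (j : Fin p → ℕ) : ℝ := ∏ r, tau m (j r)

/-- The integral approximation `A_m` (first of its six forms). -/
def approx {p : ℕ} (m : ℕ) (n : Fin p → ℕ) (f : (Fin p → ℝ) → ℝ) : ℝ :=
  ∑ j ∈ upTo p m, gamVec m j * ∑ i ∈ below j,
    boxInt (fun r => (i r : ℝ) - (j r : ℝ) / 2)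
      (fun r => (n r : ℝ) - 1 + (j r : ℝ) / 2 - (i r : ℝ)) f

/-- The remainder `R_m`. -/
def remainder {p : ℕ} (m : ℕ) (n : Fin p → ℕ) (f : (Fin p → ℝ) → ℝ) : ℝ :=
  (m : ℝ) / 2 ^ (2 * m + p - 1) *
    ∑ α ∈ ofDegree p (2 * m), 1 / (∏ r, ((α r).factorial : ℝ)) *
      ∫ s in (0 : ℝ)..1, (1 - s) ^ (2 * m - 1) *
        boxInt (fun _ => -1) (fun _ => 1) (fun v =>
          (∏ r, v r ^ α r) *
            ∑ j ∈ upTo p m, gamVec m j * (∏ r, (j r : ℝ) ^ (α r + 1)) *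
              ∑ k ∈ below n, multiDeriv α f (fun r => (k r : ℝ) + s * (j r : ℝ) * v r / 2))

/-- The first upper bound on the absolute value of the remainder. -/
def remainderBound (p m : ℕ) (M : ℝ) : ℝ :=
  M / 2 ^ (2 * m) *
    ∑ α ∈ ofDegree p (2 * m), 1 / (∏ r, ((α r + 1).factorial : ℝ)) *
      ∑ j ∈ upTo p m, |gamVec m j| * ∏ r, (j r : ℝ) ^ (α r + 1)

/-- The function `Λ(t) = (1 - t)^(t - 1) (1 + t)^(-1 - t) t²` for `0 < t < 1`. -/
def Lam (t : ℝ) : ℝ := (1 - t) ^ (t - 1) * (1 + t) ^ (-1 - t) * t ^ 2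

/-- `Λ_*`, the maximum of `Λ` on `(0, 1)` (written as a supremum). -/
def LamStar : ℝ := sSup (Lam '' Set.Ioo 0 1)

/-- The constant `κ = √(Λ_* / 4)`. -/
def kap : ℝ := Real.sqrt (LamStar / 4)

/-- The closed-form upper bound on the remainder with numerical factor `c`. -/
def closedBound (p m : ℕ) (c M : ℝ) : ℝ :=
  M * (c * (Real.pi * m) ^ (((p : ℝ) + 1) / 2) / ((2 * m + 1).factorial : ℝ)) *
    (kap * p * m) ^ (2 * m)

end

end AltSum

/-
Combining the integrals of `f` over the cubes `k + [-j/2, j/2]` with the weights `γ_{m,j}` gives a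
functional that agrees with `f k` on polynomials of degree less than `2m`: odd moments vanish by
symmetry, and `∑ γ_{m,j} j^(2l+1) = [l = 0]` for `l < m` because the `2m`-th finite difference kills
polynomials of lower degree.  Summed over `k`, the cubes telescope into the boxes of `A_m`, and
Taylor's integral remainder gives `R_m`.

For the closed bound, log-convexity of the Stirling sequence bounds
`C(2m, m+j) / C(2m, m) * (j/m)^(2m)` by `Λ(j/m)^m / √(1 - (j/m)²)`.  The factors
`1 / √(1 - (j/m)²)` form a lower Riemann sum of the derivative of `arcsin`, which is where the
factor `π m Λ_*^m` comes from; the values `m < 8` are checked numerically.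
-/

namespace AltSum

open MeasureTheory

/-! ### The coefficients -/

theorem alternating_sum_choose_mul_sub_pow {N k : ℕ} (h : k < N) (c : ℝ) :
    ∑ i ∈ Finset.range (N + 1), (-1 : ℝ) ^ i * (N.choose i : ℝ) * ((i : ℝ) - c) ^ k = 0 := by
  have hΔ := congrFun (fwdDiff_iter_pow_eq_zero_of_lt (R := ℝ) h) (-c)
  rw [fwdDiff_iter_eq_sum_shift, Pi.zero_apply] at hΔ
  rw [← mul_zero ((-1 : ℝ) ^ N), ← hΔ, Finset.mul_sum]
  refine Finset.sum_congr rfl fun i hi => ?_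
  have hsign : (-1 : ℝ) ^ i = (-1) ^ N * (-1) ^ (N - i) := by
    rw [← Nat.sub_add_cancel (Finset.mem_range_succ_iff.1 hi), Nat.add_sub_cancel, pow_add,
      mul_right_comm, ← mul_pow]
    simp
  simp only [hsign, zsmul_eq_mul, nsmul_eq_mul, mul_one]
  push_cast
  ring

theorem sum_range_two_mul_add_one_of_symm {M : Type*} [AddCommMonoid M] {F : ℕ → M} {m : ℕ}
    (hF : ∀ j ≤ m, F (m - j) = F (m + j)) :
    ∑ i ∈ Finset.range (2 * m + 1), F i = F m + 2 • ∑ j ∈ Finset.Icc 1 m, F (m + j) := by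
  have hupper : ∑ j ∈ Finset.range m, F (m + 1 + j) = ∑ j ∈ Finset.Icc 1 m, F (m + j) := by
    rw [← Finset.Ico_add_one_right_eq_Icc, Finset.sum_Ico_eq_sum_range, Nat.add_sub_cancel]
    exact Finset.sum_congr rfl fun j _ => by rw [add_assoc]
  have hlower : ∑ i ∈ Finset.range m, F i = ∑ j ∈ Finset.range m, F (m + 1 + j) := by
    rw [← Finset.sum_range_reflect]
    refine Finset.sum_congr rfl fun j hj => ?_
    rw [Finset.mem_range] at hj
    rw [Nat.sub_sub, hF _ (by omega), add_assoc]
  rw [show 2 * m + 1 = (m + 1) + m by omega, Finset.sum_range_add, Finset.sum_range_succ,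
    hlower, hupper, two_nsmul]
  abel

theorem gam_mul_self {m j : ℕ} (hj : 1 ≤ j) :
    gam m j * (j : ℝ) =
      2 * (-1) ^ (j - 1) * ((2 * m).choose (m + j) : ℝ) / ((2 * m).choose m : ℝ) := by
  rw [gam]
  field_simp

theorem sum_gam_mul_pow {m l : ℕ} (h : l < m) :
    ∑ j ∈ Finset.Icc 1 m, gam m j * (j : ℝ) ^ (2 * l + 1) = if l = 0 then 1 else 0 := by
  set C : ℝ := ((2 * m).choose m : ℝ) with hCdef
  have hC : C ≠ 0 := by rw [hCdef]; exact_mod_cast (Nat.choose_pos (by omega)).ne'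
  set F : ℕ → ℝ := fun i => (-1) ^ i * ((2 * m).choose i : ℝ) * ((i : ℝ) - m) ^ (2 * l) with hFdef
  have hsymm : ∀ j ≤ m, F (m - j) = F (m + j) := by
    intro j hj
    simp only [hFdef]
    rw [show m + j = m - j + 2 * j by omega, pow_add (-1 : ℝ), pow_mul _ 2 j,
      Nat.choose_symm_of_eq_add (show 2 * m = (m - j) + (m - j + 2 * j) by omega), Nat.cast_add,
      Nat.cast_sub hj, show (m : ℝ) - j - m = -(m - j + (2 * j : ℕ) - m) by push_cast; ring,
      (even_two_mul l).neg_pow]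
    simp
  have hupper : ∀ j ∈ Finset.Icc 1 m,
      2 * F (m + j) = (-1) ^ m * C * -(gam m j * (j : ℝ) ^ (2 * l + 1)) := by
    intro j hj
    obtain ⟨i, rfl⟩ := Nat.exists_eq_add_of_le' (Finset.mem_Icc.1 hj).1
    rw [pow_succ', ← mul_assoc (gam m _), gam_mul_self (by omega), Nat.add_sub_cancel]
    simp only [hFdef]
    rw [Nat.cast_add m, add_sub_cancel_left, ← hCdef]
    field_simp
    ring
  have hmid : F m = (-1) ^ m * C * if l = 0 then 1 else 0 := by
    simp [hFdef, hCdef, zero_pow_eq]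
  have hzero : ∑ i ∈ Finset.range (2 * m + 1), F i = 0 :=
    alternating_sum_choose_mul_sub_pow (by omega) (m : ℝ)
  rw [sum_range_two_mul_add_one_of_symm hsymm, two_nsmul, ← two_mul, Finset.mul_sum,
    Finset.sum_congr rfl hupper, hmid, ← Finset.mul_sum, ← mul_add, mul_eq_zero,
    Finset.sum_neg_distrib, ← sub_eq_add_neg, sub_eq_zero] at hzero
  exact (hzero.resolve_left (by simp [hC])).symm

theorem gam_eq_zero {m j : ℕ} (h : m < j) : gam m j = 0 := by
  rw [gam, Nat.choose_eq_zero_of_lt (by omega)]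
  simp

theorem hasSum_tau (m j : ℕ) : HasSum (fun β : ℕ => gam m (j + 2 * β)) (tau m j) := by
  refine hasSum_sum_of_ne_finset_zero fun b hb => gam_eq_zero ?_
  rw [Finset.mem_range] at hb
  omega

theorem mem_below {p : ℕ} {n k : Fin p → ℕ} : k ∈ below n ↔ ∀ r, k r < n r := by
  simp [below]

theorem mem_upTo {p m : ℕ} {j : Fin p → ℕ} : j ∈ upTo p m ↔ ∀ r, 1 ≤ j r ∧ j r ≤ m := by
  simp [upTo, Pi.le_def, forall_and]

theorem mem_symBox {p m : ℕ} {β : Fin p → ℤ} :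
    β ∈ symBox p m ↔ ∀ r, 1 - (m : ℤ) ≤ β r ∧ β r ≤ (m : ℤ) - 1 := by
  simp [symBox, Pi.le_def, forall_and]

theorem mem_signed {p : ℕ} {α : Fin p → ℕ} {β : Fin p → ℤ} : β ∈ signed α ↔ absVec β = α := by
  simp only [signed, Finset.mem_filter, Finset.mem_Icc, Pi.le_def, and_iff_right_iff_imp]
  rintro rfl
  exact ⟨fun r => by simp only [absVec]; omega, fun r => by simp only [absVec]; omega⟩

theorem sum_upTo_prod {p : ℕ} (m : ℕ) (w : Fin p → ℕ → ℝ) :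
    ∑ j ∈ upTo p m, ∏ r, w r (j r) = ∏ r, ∑ j ∈ Finset.Icc 1 m, w r j :=
  (Finset.prod_univ_sum _ _).symm

theorem sum_gamVec_mul_prod {p : ℕ} (m : ℕ) (w : Fin p → ℕ → ℝ) :
    ∑ j ∈ upTo p m, gamVec m j * ∏ r, w r (j r) =
      ∏ r, ∑ j ∈ Finset.Icc 1 m, gam m j * w r j := by
  simp only [gamVec, ← Finset.prod_mul_distrib]
  exact sum_upTo_prod m fun r j => gam m j * w r j

theorem sum_gamVec_mul_prod_self {p m : ℕ} (hm : 1 ≤ m) :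
    ∑ j ∈ upTo p m, gamVec m j * ∏ r, (j r : ℝ) = 1 := by
  have h1 : ∑ j ∈ Finset.Icc 1 m, gam m j * (j : ℝ) = 1 := by
    simpa using sum_gam_mul_pow (l := 0) hm
  rw [sum_gamVec_mul_prod m fun _ j => (j : ℝ), h1, Finset.prod_const_one]

theorem sum_gamVec_mul_sum_one {p m : ℕ} (hm : 1 ≤ m) :
    ∑ j ∈ upTo p m, gamVec m j * ∑ _i ∈ below j, (1 : ℝ) = 1 := by
  simpa [below] using sum_gamVec_mul_prod_self (p := p) hm

/- The pairs `(j, i)` with `0 ≤ i < j ≤ m` correspond to the pairs `(β, b)` with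
`1 + |β| + 2 b ≤ m` through `β = 2 i - j + 1` and `j = 1 + |β| + 2 b`. -/
theorem sum_gamVec_mul_sum_below {p : ℕ} (m : ℕ) (w : (Fin p → ℤ) → ℝ) :
    ∑ j ∈ upTo p m, gamVec m j * ∑ i ∈ below j, w (fun r => 2 * (i r : ℤ) - j r + 1) =
      ∑ β ∈ symBox p m, tauVec m (1 + absVec β) * w β := by
  simp only [tauVec, tau, Finset.prod_univ_sum, Finset.mul_sum, Finset.sum_mul]
  rw [Finset.sum_sigma', Finset.sum_sigma']
  refine Finset.sum_bij'
    (fun x _ => ⟨fun r => 2 * (x.2 r : ℤ) - x.1 r + 1,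
      fun r => (x.1 r - 1 - (2 * (x.2 r : ℤ) - x.1 r + 1).natAbs) / 2⟩)
    (fun y _ => ⟨fun r => 1 + (y.1 r).natAbs + 2 * y.2 r,
      fun r => ((y.1 r + (y.1 r).natAbs + 2 * y.2 r) / 2).toNat⟩) ?_ ?_ ?_ ?_ ?_ <;>
    rintro ⟨x, y⟩ h <;>
    simp only [Finset.mem_sigma, mem_upTo, mem_below, mem_symBox, Fintype.mem_piFinset,
      Finset.mem_range, Pi.add_apply, Pi.one_apply, absVec, ← forall_and] at h ⊢
  · intro r
    have := h r
    omega
  · intro r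
    have := h r
    omega
  · simp only [Sigma.mk.injEq, heq_eq_eq, funext_iff, ← forall_and]
    intro r
    have := h r
    omega
  · simp only [Sigma.mk.injEq, heq_eq_eq, funext_iff, ← forall_and]
    intro r
    have := h r
    omega
  · rw [gamVec]
    congr 1
    refine Finset.prod_congr rfl fun r _ => ?_
    have := h r
    congr 1
    omega

theorem sum_tauVec {p m : ℕ} (hm : 1 ≤ m) :
    ∑ β ∈ symBox p m, tauVec m (1 + absVec β) = 1 := by
  simpa only [mul_one, sum_gamVec_mul_sum_one hm] using
    (sum_gamVec_mul_sum_below (p := p) m fun _ => 1).symm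

theorem sum_below_mul_sum_signed {p m : ℕ} (hm : 1 ≤ m) (w : (Fin p → ℤ) → ℝ) :
    ∑ α ∈ below (fun _ : Fin p => m), tauVec m (1 + α) * ∑ β ∈ signed α, w β =
      ∑ β ∈ symBox p m, tauVec m (1 + absVec β) * w β := by
  have hiff : ∀ β : Fin p → ℤ, absVec β ∈ below (fun _ : Fin p => m) ↔ β ∈ symBox p m := by
    intro β
    rw [mem_below, mem_symBox]
    exact forall_congr' fun r => by simp only [absVec]; omega
  rw [← Finset.sum_fiberwise_of_maps_to fun β => (hiff β).2]
  refine Finset.sum_congr rfl fun α hα => ?_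
  have hfib : (symBox p m).filter (fun β => absVec β = α) = signed α := by
    ext β
    rw [Finset.mem_filter, mem_signed, and_iff_right_iff_imp]
    rintro rfl
    exact (hiff β).1 hα
  rw [hfib, Finset.mul_sum]
  exact Finset.sum_congr rfl fun β hβ => by rw [mem_signed.1 hβ]

theorem sum_signed_one {p m : ℕ} (hm : 1 ≤ m) :
    ∑ α ∈ below (fun _ : Fin p => m), tauVec m (1 + α) * ∑ _β ∈ signed α, (1 : ℝ) = 1 := by
  simpa only [mul_one, sum_tauVec hm] using sum_below_mul_sum_signed (p := p) hm fun _ => 1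

/-! ### Signed box integrals and the approximation -/

/-- The indicator function of the half-open interval between `u` and `v`, with the sign `-1` if
`v < u`. -/
noncomputable def signedInd (u v x : ℝ) : ℝ :=
  (Set.Iic v).indicator 1 x - (Set.Iic u).indicator 1 x

theorem signedInd_eq (u v x : ℝ) :
    signedInd u v x = (if v < u then -1 else 1) * (Set.Ioc (u ⊓ v) (u ⊔ v)).indicator 1 x := by
  simp only [signedInd, Set.indicator, Set.mem_Iic, Set.mem_Ioc, inf_lt_iff, le_sup_iff,
    Pi.one_apply]
  split_ifs <;> grind

theorem signedInd_add_mul {c : ℝ} (hc : 0 < c) (a u v x : ℝ) :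
    signedInd (a + c * u) (a + c * v) (a + c * x) = signedInd u v x := by
  simp only [signedInd, Set.indicator, Set.mem_Iic, add_le_add_iff_left, mul_le_mul_iff_right₀ hc,
    Pi.one_apply]

section

variable {p : ℕ} (u v : Fin p → ℝ) (f : (Fin p → ℝ) → ℝ)

theorem prod_signedInd_mul (x : Fin p → ℝ) :
    (∏ r, signedInd (u r) (v r) (x r)) * f x =
      (-1) ^ (Finset.univ.filter fun r => v r < u r).card *
        (Set.univ.pi fun r => Set.Ioc ((u ⊓ v) r) ((u ⊔ v) r)).indicator f x := by
  have hind : ∏ r, (Set.Ioc (u r ⊓ v r) (u r ⊔ v r)).indicator (1 : ℝ → ℝ) (x r) =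
      (Set.univ.pi fun r => Set.Ioc ((u ⊓ v) r) ((u ⊔ v) r)).indicator 1 x := by
    simp only [Set.indicator, Pi.one_apply, Finset.prod_ite_zero, Finset.prod_const_one,
      Set.mem_univ_pi, Pi.inf_apply, Pi.sup_apply, Finset.mem_univ, true_imp_iff]
  simp only [signedInd_eq]
  rw [Finset.prod_mul_distrib, hind, Finset.prod_ite, Finset.prod_const, Finset.prod_const_one,
    mul_one, mul_assoc, ← Set.indicator_mul_left]
  simp only [Pi.one_apply, one_mul]

theorem boxInt_eq_integral : boxInt u v f = ∫ x, (∏ r, signedInd (u r) (v r) (x r)) * f x := by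
  simp only [prod_signedInd_mul]
  rw [integral_const_mul, integral_indicator (MeasurableSet.univ_pi fun _ => measurableSet_Ioc),
    boxInt, volume_pi, setIntegral_congr_set Measure.univ_pi_Ioc_ae_eq_Icc]

theorem integrable_prod_signedInd_mul {f : (Fin p → ℝ) → ℝ} (hf : LocallyIntegrable f) :
    Integrable fun x => (∏ r, signedInd (u r) (v r) (x r)) * f x := by
  simp only [prod_signedInd_mul]
  refine Integrable.const_mul ?_ _
  rw [integrable_indicator_iff (MeasurableSet.univ_pi fun _ => measurableSet_Ioc)]
  exact (hf.integrableOn_isCompact isCompact_Icc).mono_set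
    ((Set.pi_mono fun _ _ => Set.Ioc_subset_Icc_self).trans (Set.pi_univ_Icc _ _).subset)

theorem boxInt_of_le {u v : Fin p → ℝ} (h : u ≤ v) : boxInt u v f = ∫ x in Set.Icc u v, f x := by
  have hfilter : (Finset.univ.filter fun r => v r < u r) = ∅ :=
    Finset.filter_false_of_mem fun r _ => (h r).not_gt
  rw [boxInt, hfilter, inf_eq_left.2 h, sup_eq_right.2 h, Finset.card_empty, pow_zero, one_mul]

theorem boxInt_prod (g : Fin p → ℝ → ℝ) :
    boxInt u v (fun x => ∏ r, g r (x r)) = ∏ r, ∫ x in u r..v r, g r x := by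
  have hone : ∀ r, ∫ x in u r..v r, g r x = ∫ x, signedInd (u r) (v r) x * g r x := by
    intro r
    simp only [signedInd_eq, mul_assoc, ← Set.indicator_mul_left, Pi.one_apply, one_mul]
    rw [integral_const_mul, integral_indicator measurableSet_Ioc]
    split_ifs with h
    · rw [intervalIntegral.integral_of_ge h.le, inf_eq_right.2 h.le, sup_eq_left.2 h.le,
        neg_one_mul]
    · rw [intervalIntegral.integral_of_le (not_lt.1 h), inf_eq_left.2 (not_lt.1 h),
        sup_eq_right.2 (not_lt.1 h), one_mul]
  simp only [boxInt_eq_integral, ← Finset.prod_mul_distrib, hone]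
  exact integral_fintype_prod_volume_eq_prod fun r x => signedInd (u r) (v r) x * g r x

theorem abs_prod_mul_integral_comp_mul {ι E : Type*} [Fintype ι] [NormedAddCommGroup E]
    [NormedSpace ℝ E] {c : ι → ℝ} (hc : ∀ i, c i ≠ 0) (g : (ι → ℝ) → E) :
    |∏ i, c i| • ∫ x, g (c * x) = ∫ x, g x := by
  classical
  have hdet : (Matrix.diagonal c).det ≠ 0 := by
    rw [Matrix.det_diagonal]
    exact Finset.prod_ne_zero_iff.2 fun i _ => hc i
  have hcoe : ⇑(Matrix.toLin' (Matrix.diagonal c)) = fun x => c * x := by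
    ext x i
    rw [Matrix.toLin'_apply, Matrix.mulVec_diagonal, Pi.mul_apply]
  have hemb : MeasurableEmbedding fun x : ι → ℝ => c * x :=
    (Homeomorph.piCongrRight fun i => Homeomorph.mulLeft₀ (c i) (hc i)).measurableEmbedding
  conv_rhs => rw [← Real.smul_map_diagonal_volume_pi hdet]
  rw [integral_smul_measure, hcoe, hemb.integral_map, Matrix.det_diagonal,
    ENNReal.toReal_ofReal (abs_nonneg _)]

theorem boxInt_add_mul {c : Fin p → ℝ} (hc : ∀ r, 0 < c r) (a : Fin p → ℝ) :
    boxInt (a + c * u) (a + c * v) f = (∏ r, c r) * boxInt u v (fun x => f (a + c * x)) := by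
  simp only [boxInt_eq_integral]
  rw [← integral_add_left_eq_self _ a, ← abs_prod_mul_integral_comp_mul fun r => (hc r).ne',
    abs_of_pos (Finset.prod_pos fun r _ => hc r), smul_eq_mul]
  simp only [Pi.add_apply, Pi.mul_apply, signedInd_add_mul (hc _)]

end

/- Expanding the products of one-dimensional signed indicators reduces an identity between sums of
box integrals to telescoping identities in each coordinate. -/
theorem sum_below_boxInt_eq {p : ℕ} {N N' : Fin p → ℕ} {a b a' b' : Fin p → ℕ → ℝ}
    (h : ∀ r (H : ℝ → ℝ), ∑ i ∈ Finset.range (N r), (H (b r i) - H (a r i)) =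
      ∑ k ∈ Finset.range (N' r), (H (b' r k) - H (a' r k)))
    {f : (Fin p → ℝ) → ℝ} (hf : LocallyIntegrable f) :
    ∑ i ∈ below N, boxInt (fun r => a r (i r)) (fun r => b r (i r)) f =
      ∑ k ∈ below N', boxInt (fun r => a' r (k r)) (fun r => b' r (k r)) f := by
  simp only [boxInt_eq_integral]
  rw [← integral_finsetSum _ fun i _ => integrable_prod_signedInd_mul _ _ hf,
    ← integral_finsetSum _ fun k _ => integrable_prod_signedInd_mul _ _ hf]
  simp only [← Finset.sum_mul]
  refine integral_congr_ae (.of_forall fun x => congrArg (· * f x) ?_)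
  rw [below, ← Finset.prod_univ_sum _ fun r i => signedInd (a r i) (b r i) (x r),
    below, ← Finset.prod_univ_sum _ fun r k => signedInd (a' r k) (b' r k) (x r)]
  exact Finset.prod_congr rfl fun r _ => h r fun t => (Set.Iic t).indicator 1 (x r)

theorem sum_range_add_sub {M : Type*} [AddCommGroup M] (G : ℕ → M) (n j : ℕ) :
    ∑ k ∈ Finset.range n, (G (k + j) - G k) = ∑ i ∈ Finset.range j, (G (n + i) - G i) := by
  have h := Finset.sum_range_add G n j
  rw [add_comm n j, Finset.sum_range_add G j n] at h
  simp only [Finset.sum_sub_distrib, add_comm _ j, sub_eq_sub_iff_add_eq_add]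
  rw [add_comm, h, add_comm]

theorem sum_range_sub_half_reflect (H : ℝ → ℝ) (j : ℕ) :
    ∑ i ∈ Finset.range j, H ((i : ℝ) - (j : ℝ) / 2) =
      ∑ i ∈ Finset.range j, H (-1 + (j : ℝ) / 2 - i) := by
  rw [← Finset.sum_range_reflect]
  refine Finset.sum_congr rfl fun i hi => congrArg H ?_
  rw [Nat.sub_sub, Nat.cast_sub (by rw [Finset.mem_range] at hi; omega), Nat.cast_add, Nat.cast_one]
  ring

theorem sum_shifted_differences (H : ℝ → ℝ) (n j : ℕ) :
    ∑ i ∈ Finset.range j, (H ((n : ℝ) - 1 + (j : ℝ) / 2 - i) - H ((i : ℝ) - (j : ℝ) / 2)) =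
      ∑ k ∈ Finset.range n, (H ((k : ℝ) + (j : ℝ) / 2) - H ((k : ℝ) - (j : ℝ) / 2)) := by
  have htele := sum_range_add_sub (fun k : ℕ => H ((k : ℝ) - (j : ℝ) / 2)) n j
  have hrefl := sum_range_sub_half_reflect (fun x => H (n + x)) j
  simp only [Finset.sum_sub_distrib] at htele ⊢
  have hleft (k : ℕ) : ((k + j : ℕ) : ℝ) - (j : ℝ) / 2 = k + (j : ℝ) / 2 := by push_cast; ring
  have hright (i : ℕ) : ((n + i : ℕ) : ℝ) - (j : ℝ) / 2 = n + (i - (j : ℝ) / 2) := by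
    push_cast; ring
  have hupper (i : ℕ) : (n : ℝ) - 1 + (j : ℝ) / 2 - i = n + (-1 + (j : ℝ) / 2 - i) := by ring
  simp only [hleft, hright, hupper] at htele ⊢
  rw [htele, hrefl]

section

variable {p : ℕ} (m : ℕ) (n : Fin p → ℕ) {f : (Fin p → ℝ) → ℝ}

theorem approx_eq_sum_translates (hf : LocallyIntegrable f) :
    approx m n f = ∑ j ∈ upTo p m, gamVec m j * ∑ k ∈ below n,
      boxInt (fun r => (k r : ℝ) - (j r : ℝ) / 2) (fun r => (k r : ℝ) + (j r : ℝ) / 2) f :=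
  Finset.sum_congr rfl fun j _ => congrArg _ <|
    sum_below_boxInt_eq (a := fun r i => (i : ℝ) - (j r : ℝ) / 2)
      (b := fun r i => (n r : ℝ) - 1 + (j r : ℝ) / 2 - i)
      (a' := fun r k => (k : ℝ) - (j r : ℝ) / 2) (b' := fun r k => (k : ℝ) + (j r : ℝ) / 2)
      (fun r H => sum_shifted_differences H (n r) (j r)) hf

theorem approx_eq_sum_reflect (hf : LocallyIntegrable f) :
    approx m n f = ∑ j ∈ upTo p m, gamVec m j * ∑ i ∈ below j,
      boxInt (fun r => -1 + (j r : ℝ) / 2 - (i r : ℝ))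
        (fun r => (n r : ℝ) - 1 + (j r : ℝ) / 2 - (i r : ℝ)) f :=
  Finset.sum_congr rfl fun j _ => congrArg _ <|
    sum_below_boxInt_eq (a := fun r i => (i : ℝ) - (j r : ℝ) / 2)
      (b := fun r i => (n r : ℝ) - 1 + (j r : ℝ) / 2 - i)
      (a' := fun r i => -1 + (j r : ℝ) / 2 - (i : ℝ))
      (b' := fun r i => (n r : ℝ) - 1 + (j r : ℝ) / 2 - i)
      (fun r H => by
        rw [Finset.sum_sub_distrib, Finset.sum_sub_distrib, sum_range_sub_half_reflect]) hf

theorem approx_eq_sum_tauVec (f : (Fin p → ℝ) → ℝ) :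
    approx m n f = ∑ β ∈ symBox p m, tauVec m (1 + absVec β) *
      boxInt (fun r => (β r : ℝ) / 2 - 1 / 2) (fun r => (n r : ℝ) - 1 / 2 - (β r : ℝ) / 2) f := by
  rw [← sum_gamVec_mul_sum_below, approx]
  refine Finset.sum_congr rfl fun j _ => congrArg _ <| Finset.sum_congr rfl fun i _ => ?_
  congr 1 <;> ext r <;> push_cast <;> ring

theorem approx_eq_sum_tauVec_reflect (hf : LocallyIntegrable f) :
    approx m n f = ∑ β ∈ symBox p m, tauVec m (1 + absVec β) *
      boxInt (fun r => -1 / 2 - (β r : ℝ) / 2) (fun r => (n r : ℝ) - 1 / 2 - (β r : ℝ) / 2) f := by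
  rw [← sum_gamVec_mul_sum_below, approx_eq_sum_reflect m n hf]
  refine Finset.sum_congr rfl fun j _ => congrArg _ <| Finset.sum_congr rfl fun i _ => ?_
  congr 1 <;> ext r <;> push_cast <;> ring

end

/-! ### Iterated partial derivatives and Taylor's formula -/

section

variable {p : ℕ} {f : (Fin p → ℝ) → ℝ}

theorem partialDeriv_eq_fderiv (hf : Differentiable ℝ f) (r : Fin p) :
    partialDeriv r f = fun x => fderiv ℝ f x (Pi.single r 1) :=
  funext fun x => (hf x).lineDeriv_eq_fderiv

theorem contDiff_partialDeriv {N : ℕ} (hf : ContDiff ℝ ((N + 1 : ℕ) : WithTop ℕ∞) f) (r : Fin p) :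
    ContDiff ℝ (N : WithTop ℕ∞) (partialDeriv r f) := by
  rw [partialDeriv_eq_fderiv (hf.differentiable (by simp))]
  exact (hf.fderiv_right (by norm_cast)).clm_apply contDiff_const

theorem partialDeriv_comm (hf : ContDiff ℝ ((2 : ℕ) : WithTop ℕ∞) f) (r s : Fin p) :
    partialDeriv r (partialDeriv s f) = partialDeriv s (partialDeriv r f) := by
  have hd : Differentiable ℝ f := hf.differentiable (by simp)
  have hd2 : Differentiable ℝ (fderiv ℝ f) :=
    (hf.fderiv_right (m := 1) (by norm_cast)).differentiable (by simp)
  have hsnd : ∀ a b : Fin p, ∀ x, partialDeriv a (partialDeriv b f) x =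
      fderiv ℝ (fderiv ℝ f) x (Pi.single a 1) (Pi.single b 1) := by
    intro a b x
    rw [partialDeriv_eq_fderiv ((contDiff_partialDeriv (N := 1) hf b).differentiable (by simp)),
      partialDeriv_eq_fderiv hd]
    simp [fderiv_clm_apply (hd2 x) (differentiableAt_const _)]
  funext x
  rw [hsnd, hsnd]
  exact (hf.contDiffAt.isSymmSndFDerivAt (by simp)) _ _

/-- The iterated partial derivative along the coordinates in a list, the head being applied last.
Unlike `multiDeriv` it allows any order of differentiation. -/
noncomputable def listDeriv (l : List (Fin p)) (f : (Fin p → ℝ) → ℝ) : (Fin p → ℝ) → ℝ :=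
  l.foldr partialDeriv f

theorem contDiff_listDeriv {N : ℕ} (l : List (Fin p))
    (hf : ContDiff ℝ ((N + l.length : ℕ) : WithTop ℕ∞) f) :
    ContDiff ℝ (N : WithTop ℕ∞) (listDeriv l f) := by
  induction l generalizing N with
  | nil => exact hf
  | cons r l ih =>
    refine contDiff_partialDeriv (ih ?_) r
    rwa [add_assoc, add_comm 1]

theorem listDeriv_perm {l l' : List (Fin p)} (h : l.Perm l')
    (hf : ContDiff ℝ (l.length : WithTop ℕ∞) f) : listDeriv l f = listDeriv l' f := by
  induction h with
  | nil => rfl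
  | cons r _ ih => exact congrArg (partialDeriv r) (ih (hf.of_le (by simp)))
  | swap r s l =>
    refine partialDeriv_comm (contDiff_listDeriv l ?_) s r
    rwa [add_comm]
  | trans h _ ih ih' => rw [ih hf, ih' (h.length_eq ▸ hf)]

/-- The list in which every coordinate `r` occurs `α r` times, in increasing order. -/
def multiIndexList (α : Fin p → ℕ) : List (Fin p) :=
  (List.finRange p).flatMap fun r => List.replicate (α r) r

theorem multiDeriv_eq_listDeriv (α : Fin p → ℕ) (f : (Fin p → ℝ) → ℝ) :
    multiDeriv α f = listDeriv (multiIndexList α) f := by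
  simp only [multiDeriv, listDeriv, multiIndexList, List.foldr_flatMap]
  congr! 3 with r g
  induction α r with
  | zero => rfl
  | succ k ih => rw [Function.iterate_succ_apply', ih]; rfl

theorem count_multiIndexList (α : Fin p → ℕ) (r : Fin p) :
    (multiIndexList α).count r = α r := by
  simp [multiIndexList, List.count_flatMap, List.count_replicate, Function.comp_def,
    ← List.ofFn_eq_map, List.sum_ofFn]

theorem length_multiIndexList (α : Fin p → ℕ) : (multiIndexList α).length = ∑ r, α r := by
  simp [multiIndexList, List.length_flatMap, ← List.ofFn_eq_map, List.sum_ofFn]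

theorem continuous_multiDeriv {N : ℕ} {α : Fin p → ℕ} (hf : ContDiff ℝ (N : WithTop ℕ∞) f)
    (hα : ∑ r, α r ≤ N) : Continuous (multiDeriv α f) := by
  rw [multiDeriv_eq_listDeriv]
  refine (contDiff_listDeriv (N := 0) _ (hf.of_le ?_)).continuous
  rw [length_multiIndexList, zero_add]
  exact_mod_cast hα

theorem multiDeriv_partialDeriv {α : Fin p → ℕ}
    (hf : ContDiff ℝ ((∑ r, α r + 1 : ℕ) : WithTop ℕ∞) f) (r : Fin p) :
    multiDeriv α (partialDeriv r f) = multiDeriv (α + Pi.single r 1) f := by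
  have hperm : (multiIndexList α ++ [r]).Perm (multiIndexList (α + Pi.single r 1)) := by
    refine List.perm_iff_count.2 fun s => ?_
    rw [List.count_append, count_multiIndexList, count_multiIndexList, List.count_singleton]
    rcases eq_or_ne s r with rfl | hs
    · simp
    · simp [hs, hs.symm]
  rw [multiDeriv_eq_listDeriv, multiDeriv_eq_listDeriv, ← listDeriv_perm hperm, listDeriv,
    listDeriv, List.foldr_append]
  · rfl
  · rwa [List.length_append, length_multiIndexList, List.length_singleton]

theorem multiDeriv_zero (f : (Fin p → ℝ) → ℝ) : multiDeriv 0 f = f := by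
  rw [multiDeriv_eq_listDeriv, List.eq_nil_of_length_eq_zero (l := multiIndexList 0)
    (by simp [length_multiIndexList])]
  rfl

theorem mem_ofDegree {d : ℕ} {α : Fin p → ℕ} : α ∈ ofDegree p d ↔ ∑ r, α r = d := by
  simp [ofDegree]

theorem sum_ofDegree_succ_sum {M : Type*} [AddCommMonoid M] (d : ℕ)
    (h : (Fin p → ℕ) → Fin p → M) (h0 : ∀ β r, β r = 0 → h β r = 0) :
    ∑ β ∈ ofDegree p (d + 1), ∑ r, h β r =
      ∑ α ∈ ofDegree p d, ∑ r, h (α + Pi.single r 1) r := by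
  rw [Finset.sum_comm, Finset.sum_comm (s := ofDegree p d)]
  refine Finset.sum_congr rfl fun r _ => ?_
  have hsum : ∀ α : Fin p → ℕ, ∑ s, (α + Pi.single r 1 : Fin p → ℕ) s = ∑ s, α s + 1 := fun α => by
    simp [Finset.sum_add_distrib]
  refine (Finset.sum_of_injOn (fun α => α + Pi.single r 1) (add_left_injective _).injOn ?_ ?_
    fun _ _ => rfl).symm
  · intro α hα
    rw [Finset.mem_coe, mem_ofDegree] at hα ⊢
    rw [hsum, hα]
  · intro β hβ hnot
    by_contra hne
    have hr : β r ≠ 0 := fun hr => hne (h0 β r hr)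
    have hcancel : β - Pi.single r 1 + Pi.single r 1 = β :=
      tsub_add_cancel_of_le fun s => by
        rcases eq_or_ne s r with rfl | hs
        · simpa using Nat.one_le_iff_ne_zero.2 hr
        · simp [hs]
    refine hnot ⟨β - Pi.single r 1, ?_, hcancel⟩
    rw [mem_ofDegree] at hβ
    rw [Finset.mem_coe, mem_ofDegree, ← Nat.add_right_cancel_iff (n := 1), ← hsum, hcancel, hβ]

theorem prod_add_single {M : Type*} [CommMonoid M] (g : Fin p → ℕ → M) (α : Fin p → ℕ)
    (r : Fin p) : ∏ s, g s ((α + Pi.single r 1 : Fin p → ℕ) s) =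
      g r (α r + 1) * ∏ s ∈ Finset.univ.erase r, g s (α s) := by
  rw [← Finset.mul_prod_erase _ _ (Finset.mem_univ r)]
  congr 1
  · simp
  · refine Finset.prod_congr rfl fun s hs => ?_
    simp [Finset.ne_of_mem_erase hs]

theorem sum_ofDegree_add_single (d : ℕ) (T : (Fin p → ℕ) → ℝ) :
    ∑ α ∈ ofDegree p d, ∑ r, (d.factorial : ℝ) / (∏ s, ((α s).factorial : ℝ)) *
        T (α + Pi.single r 1) =
      ∑ β ∈ ofDegree p (d + 1), ((d + 1).factorial : ℝ) / (∏ s, ((β s).factorial : ℝ)) * T β := by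
  have hdistrib : ∀ β ∈ ofDegree p (d + 1),
      ((d + 1).factorial : ℝ) / (∏ s, ((β s).factorial : ℝ)) * T β =
        ∑ r, β r * (d.factorial / (∏ s, ((β s).factorial : ℝ)) * T β) := by
    intro β hβ
    rw [← Finset.sum_mul, ← Nat.cast_sum, mem_ofDegree.1 hβ, Nat.factorial_succ, Nat.cast_mul]
    ring
  rw [Finset.sum_congr rfl hdistrib, sum_ofDegree_succ_sum d
    (fun β r => (β r : ℝ) * (d.factorial / (∏ s, ((β s).factorial : ℝ)) * T β))
    fun β r hr => by simp [hr]]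
  refine Finset.sum_congr rfl fun α _ => Finset.sum_congr rfl fun r _ => ?_
  rw [prod_add_single (fun _ k => (k.factorial : ℝ)), Nat.factorial_succ,
    ← Finset.mul_prod_erase Finset.univ (fun s => ((α s).factorial : ℝ)) (Finset.mem_univ r)]
  simp only [Pi.add_apply, Pi.single_eq_same]
  push_cast
  field_simp

theorem hasDerivAt_comp_line (hf : Differentiable ℝ f) (k w : Fin p → ℝ) (t : ℝ) :
    HasDerivAt (fun t : ℝ => f (k + t • w)) (∑ r, w r * partialDeriv r f (k + t • w)) t := by
  have hline : HasDerivAt (fun t : ℝ => k + t • w) w t := by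
    simpa using ((hasDerivAt_id t).smul_const w).const_add k
  have hfderiv : fderiv ℝ f (k + t • w) w = ∑ r, w r * partialDeriv r f (k + t • w) := by
    rw [← (fderiv ℝ f (k + t • w)).sum_comp_single ℝ (fun _ => ℝ)]
    refine Finset.sum_congr rfl fun r _ => ?_
    rw [partialDeriv_eq_fderiv hf, ← smul_eq_mul, ← map_smul, ← Pi.single_smul]
    simp
  exact hfderiv ▸ (hf (k + t • w)).hasFDerivAt.comp_hasDerivAt t hline

theorem contDiff_comp_line {N : WithTop ℕ∞} (hf : ContDiff ℝ N f) (k w : Fin p → ℝ) :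
    ContDiff ℝ N fun t : ℝ => f (k + t • w) :=
  hf.comp (contDiff_const.add (contDiff_id.smul contDiff_const))

theorem iteratedDeriv_comp_line {d : ℕ} (hf : ContDiff ℝ (d : WithTop ℕ∞) f)
    (k w : Fin p → ℝ) (t : ℝ) :
    iteratedDeriv d (fun t : ℝ => f (k + t • w)) t =
      ∑ α ∈ ofDegree p d, (d.factorial : ℝ) / (∏ r, ((α r).factorial : ℝ)) *
        ((∏ r, w r ^ α r) * multiDeriv α f (k + t • w)) := by
  induction d generalizing f with
  | zero => simp [ofDegree, multiDeriv_zero]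
  | succ d ih =>
    have hpd : ∀ r, ContDiff ℝ (d : WithTop ℕ∞) (partialDeriv r f) := contDiff_partialDeriv hf
    have hder : deriv (fun t : ℝ => f (k + t • w)) =
        fun t => ∑ r, w r * partialDeriv r f (k + t • w) :=
      funext fun t => (hasDerivAt_comp_line (hf.differentiable (by simp)) k w t).deriv
    rw [iteratedDeriv_succ', hder, iteratedDeriv_fun_sum fun r _ =>
      (contDiff_const.mul (contDiff_comp_line (hpd r) k w)).contDiffAt,
      ← sum_ofDegree_add_single d fun α => (∏ r, w r ^ α r) * multiDeriv α f (k + t • w),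
      Finset.sum_comm]
    refine Finset.sum_congr rfl fun r _ => ?_
    rw [iteratedDeriv_const_mul_field, ih (hpd r), Finset.mul_sum]
    refine Finset.sum_congr rfl fun α hα => ?_
    rw [multiDeriv_partialDeriv (by rwa [mem_ofDegree.1 hα]),
      prod_add_single (fun s k => w s ^ k), pow_succ,
      ← Finset.mul_prod_erase Finset.univ (fun s => w s ^ α s) (Finset.mem_univ r)]
    ring

theorem taylorWithinEval_comp_line {N : ℕ} (hf : ContDiff ℝ (N : WithTop ℕ∞) f)
    (k w : Fin p → ℝ) :
    taylorWithinEval (fun t : ℝ => f (k + t • w)) N (Set.uIcc 0 1) 0 1 =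
      ∑ d ∈ Finset.range (N + 1), ∑ α ∈ ofDegree p d,
        1 / (∏ r, ((α r).factorial : ℝ)) * ((∏ r, w r ^ α r) * multiDeriv α f k) := by
  rw [taylor_within_apply]
  refine Finset.sum_congr rfl fun d hd => ?_
  have hfd : ContDiff ℝ (d : WithTop ℕ∞) f :=
    hf.of_le (by exact_mod_cast Finset.mem_range_succ_iff.1 hd)
  rw [iteratedDerivWithin_eq_iteratedDeriv (uniqueDiffOn_uIcc zero_ne_one)
      (contDiff_comp_line hfd k w).contDiffAt Set.left_mem_uIcc,
    iteratedDeriv_comp_line hfd, smul_eq_mul, Finset.mul_sum]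
  refine Finset.sum_congr rfl fun α _ => ?_
  simp only [sub_zero, one_pow, mul_one, zero_smul, add_zero]
  field_simp

theorem taylor_multiDeriv {N : ℕ} (hf : ContDiff ℝ ((N + 1 : ℕ) : WithTop ℕ∞) f)
    (k w : Fin p → ℝ) :
    f (k + w) =
      (∑ d ∈ Finset.range (N + 1), ∑ α ∈ ofDegree p d,
        1 / (∏ r, ((α r).factorial : ℝ)) * ((∏ r, w r ^ α r) * multiDeriv α f k)) +
      ∑ α ∈ ofDegree p (N + 1), (N + 1 : ℝ) / (∏ r, ((α r).factorial : ℝ)) *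
        ∫ s in (0 : ℝ)..1, (1 - s) ^ N * ((∏ r, w r ^ α r) * multiDeriv α f (k + s • w)) := by
  have htaylor := taylor_integral_remainder (x := 1) (x₀ := 0) (n := N)
    (contDiff_comp_line hf k w).contDiffOn
  rw [taylorWithinEval_comp_line (hf.of_le (by norm_cast; omega)), one_smul,
    sub_eq_iff_eq_add'] at htaylor
  rw [htaylor]
  congr 1
  have hintegrand : ∀ s ∈ Set.uIcc (0 : ℝ) 1, ((1 - s) ^ N / (N.factorial : ℝ)) •
      iteratedDerivWithin (N + 1) (fun t : ℝ => f (k + t • w)) (Set.uIcc 0 1) s =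
      ∑ α ∈ ofDegree p (N + 1), (N + 1 : ℝ) / (∏ r, ((α r).factorial : ℝ)) *
        ((1 - s) ^ N * ((∏ r, w r ^ α r) * multiDeriv α f (k + s • w))) := by
    intro s hs
    rw [iteratedDerivWithin_eq_iteratedDeriv (uniqueDiffOn_uIcc zero_ne_one)
        (contDiff_comp_line hf k w).contDiffAt hs,
      iteratedDeriv_comp_line hf, smul_eq_mul, Finset.mul_sum]
    refine Finset.sum_congr rfl fun α _ => ?_
    rw [Nat.factorial_succ]
    push_cast
    field_simp
  rw [intervalIntegral.integral_congr hintegrand, intervalIntegral.integral_finsetSum]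
  · simp only [intervalIntegral.integral_const_mul]
  · intro α hα
    have := continuous_multiDeriv hf (mem_ofDegree.1 hα).le
    exact Continuous.intervalIntegrable (by fun_prop) _ _

end

/-! ### The summation formula -/

section

variable {p : ℕ} (u v : Fin p → ℝ)

theorem boxInt_const_mul (c : ℝ) (g : (Fin p → ℝ) → ℝ) :
    boxInt u v (fun x => c * g x) = c * boxInt u v g := by
  rw [boxInt, boxInt, integral_const_mul, mul_left_comm]

theorem boxInt_add {g h : (Fin p → ℝ) → ℝ} (hg : Continuous g) (hh : Continuous h) :
    boxInt u v (fun x => g x + h x) = boxInt u v g + boxInt u v h := by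
  rw [boxInt, integral_add (hg.continuousOn.integrableOn_compact isCompact_Icc)
    (hh.continuousOn.integrableOn_compact isCompact_Icc), mul_add, boxInt, boxInt]

theorem boxInt_finsetSum {ι : Type*} (s : Finset ι) {g : ι → (Fin p → ℝ) → ℝ}
    (hg : ∀ i ∈ s, Continuous (g i)) :
    boxInt u v (fun x => ∑ i ∈ s, g i x) = ∑ i ∈ s, boxInt u v (g i) := by
  simp only [boxInt]
  rw [integral_finsetSum s fun i hi => (hg i hi).continuousOn.integrableOn_compact isCompact_Icc,
    Finset.mul_sum]

theorem continuous_boxInt {X : Type*} [TopologicalSpace X] [FirstCountableTopology X]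
    [LocallyCompactSpace X] {F : X → (Fin p → ℝ) → ℝ}
    (hF : Continuous (Function.uncurry F)) : Continuous fun s => boxInt u v (F s) :=
  continuous_const.mul (continuous_parametric_integral_of_continuous hF isCompact_Icc)

theorem boxInt_intervalIntegral {F : ℝ → (Fin p → ℝ) → ℝ} (hF : Continuous (Function.uncurry F))
    (a b : ℝ) : boxInt u v (fun x => ∫ s in a..b, F s x) = ∫ s in a..b, boxInt u v (F s) := by
  simp only [boxInt]
  rw [intervalIntegral.integral_const_mul, intervalIntegral_integral_swap]
  rw [Measure.prod_restrict]
  exact (hF.continuousOn.integrableOn_compact (isCompact_uIcc.prod isCompact_Icc)).mono_set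
    (Set.prod_mono Set.uIoc_subset_uIcc subset_rfl)

end

theorem sum_gam_mul_integral_pow {m e : ℕ} (he : e < 2 * m) :
    ∑ j ∈ Finset.Icc 1 m, gam m j * ∫ x in -(j : ℝ) / 2..(j : ℝ) / 2, x ^ e =
      if e = 0 then 1 else 0 := by
  simp only [integral_pow, neg_div]
  rcases Nat.even_or_odd' e with ⟨l, rfl | rfl⟩
  · have hterm : ∀ j : ℕ, gam m j *
        ((((j : ℝ) / 2) ^ (2 * l + 1) - (-((j : ℝ) / 2)) ^ (2 * l + 1)) / ((2 * l : ℕ) + 1)) =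
          (4 ^ l * (2 * l + 1) : ℝ)⁻¹ * (gam m j * (j : ℝ) ^ (2 * l + 1)) := by
      intro j
      rw [(odd_two_mul_add_one l).neg_pow, div_pow, pow_succ 2, pow_mul 2]
      push_cast
      norm_num
      field_simp
      norm_num
    rw [Finset.sum_congr rfl fun j _ => hterm j, ← Finset.mul_sum, sum_gam_mul_pow (by omega)]
    rcases eq_or_ne l 0 with rfl | hl
    · simp
    · simp [hl]
  · simp [(show Even (2 * l + 1 + 1) by exact ⟨l + 1, by ring⟩).neg_pow]

section

variable {p : ℕ} (m : ℕ)

/-- The linear combination `∑ γ_{m,j} ∫_{-j/2}^{j/2} g` of integrals over boxes centred at `0`. -/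
noncomputable def quad (g : (Fin p → ℝ) → ℝ) : ℝ :=
  ∑ j ∈ upTo p m, gamVec m j * boxInt (fun r => -(j r : ℝ) / 2) (fun r => (j r : ℝ) / 2) g

theorem quad_const_mul (c : ℝ) (g : (Fin p → ℝ) → ℝ) :
    quad m (fun w => c * g w) = c * quad m g := by
  simp only [quad, boxInt_const_mul, Finset.mul_sum, mul_left_comm c]

theorem quad_add {g h : (Fin p → ℝ) → ℝ} (hg : Continuous g) (hh : Continuous h) :
    quad m (fun w => g w + h w) = quad m g + quad m h := by
  simp only [quad, boxInt_add _ _ hg hh, mul_add, Finset.sum_add_distrib]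

theorem quad_finsetSum {ι : Type*} (s : Finset ι) {g : ι → (Fin p → ℝ) → ℝ}
    (hg : ∀ i ∈ s, Continuous (g i)) :
    quad m (fun w => ∑ i ∈ s, g i w) = ∑ i ∈ s, quad m (g i) := by
  simp only [quad, boxInt_finsetSum _ _ s hg, Finset.mul_sum]
  exact Finset.sum_comm

theorem quad_intervalIntegral {F : ℝ → (Fin p → ℝ) → ℝ} (hF : Continuous (Function.uncurry F))
    (a b : ℝ) : quad m (fun w => ∫ s in a..b, F s w) = ∫ s in a..b, quad m (F s) := by
  simp only [quad, boxInt_intervalIntegral _ _ hF]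
  rw [intervalIntegral.integral_finsetSum fun j _ =>
    ((continuous_boxInt _ _ hF).const_mul _).intervalIntegrable a b]
  simp only [intervalIntegral.integral_const_mul]

theorem quad_eq_boxInt {g : (Fin p → ℝ) → ℝ} (hg : Continuous g) :
    quad m g = boxInt (fun _ => -1) (fun _ => 1) fun v => ∑ j ∈ upTo p m,
      gamVec m j * (∏ r, (j r : ℝ) / 2) * g (fun r => (j r : ℝ) / 2 * v r) := by
  rw [boxInt_finsetSum _ _ _ fun j _ => by fun_prop]
  refine Finset.sum_congr rfl fun j hj => ?_
  have hscale := boxInt_add_mul (fun _ => -1) (fun _ => 1) g (c := fun r => (j r : ℝ) / 2)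
    (fun r => half_pos (Nat.cast_pos.2 (mem_upTo.1 hj r).1)) 0
  simp only [zero_add] at hscale
  rw [boxInt_const_mul, mul_assoc]
  refine congrArg (gamVec m j * ·) (Eq.trans ?_ hscale)
  congr 1 <;> ext r <;> simp only [Pi.mul_apply] <;> ring

theorem quad_monomial {α : Fin p → ℕ} (hα : ∑ r, α r < 2 * m) :
    quad m (fun w => ∏ r, w r ^ α r) = if α = 0 then 1 else 0 := by
  have hdeg : ∀ r, α r < 2 * m := fun r =>
    (Finset.single_le_sum (fun _ _ => Nat.zero_le _) (Finset.mem_univ r)).trans_lt hα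
  simp only [quad, boxInt_prod _ _ fun r x => x ^ α r]
  rw [sum_gamVec_mul_prod m fun r j => ∫ x in -(j : ℝ) / 2..(j : ℝ) / 2, x ^ α r]
  simp only [sum_gam_mul_integral_pow (hdeg _), Finset.prod_ite_zero, Finset.prod_const_one,
    Finset.mem_univ, true_imp_iff, funext_iff, Pi.zero_apply]

theorem quad_polynomial (hm : 1 ≤ m) (c : (Fin p → ℕ) → ℝ) :
    quad m (fun w => ∑ d ∈ Finset.range (2 * m), ∑ α ∈ ofDegree p d, c α * ∏ r, w r ^ α r) =
      c 0 := by
  have hterm : ∀ d ∈ Finset.range (2 * m), ∀ α ∈ ofDegree p d,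
      quad m (fun w => c α * ∏ r, w r ^ α r) = if α = 0 then c 0 else 0 := by
    intro d hd α hα
    rw [quad_const_mul, quad_monomial m (by rwa [mem_ofDegree.1 hα, ← Finset.mem_range]), mul_ite,
      mul_one, mul_zero]
    split_ifs with h <;> simp only [h]
  rw [quad_finsetSum _ _ fun d _ => by fun_prop, Finset.sum_eq_single_of_mem 0 (by simp; omega)]
  · rw [quad_finsetSum _ _ fun α _ => by fun_prop, Finset.sum_congr rfl (hterm 0 (by simp; omega)),
      Finset.sum_ite_eq', if_pos (mem_ofDegree.2 (by simp))]
  · intro d hd hd0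
    rw [quad_finsetSum _ _ fun α _ => by fun_prop, Finset.sum_congr rfl (hterm d hd)]
    refine Finset.sum_eq_zero fun α hα => if_neg ?_
    rintro rfl
    exact hd0 (by simpa using (mem_ofDegree.1 hα).symm)

end

section

variable {p : ℕ} (n : Fin p → ℕ) {f : (Fin p → ℝ) → ℝ}

/-- The sum of `f` over the translate by `u` of the lattice points `k` with `0 ≤ k ≤ n - 1`. -/
def latticeSum (f : (Fin p → ℝ) → ℝ) (u : Fin p → ℝ) : ℝ :=
  ∑ k ∈ below n, f ((fun r => (k r : ℝ)) + u)

theorem continuous_latticeSum (hf : Continuous f) : Continuous (latticeSum n f) := by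
  unfold latticeSum
  fun_prop

theorem approx_eq_quad (m : ℕ) (hf : Continuous f) : approx m n f = quad m (latticeSum n f) := by
  rw [approx_eq_sum_translates m n hf.locallyIntegrable]
  refine Finset.sum_congr rfl fun j _ => congrArg _ ?_
  unfold latticeSum
  rw [boxInt_finsetSum _ _ _ fun k _ => by fun_prop]
  refine Finset.sum_congr rfl fun k _ => ?_
  have htranslate := boxInt_add_mul (fun r => -(j r : ℝ) / 2) (fun r => (j r : ℝ) / 2) f
    (c := 1) (fun _ => one_pos) (fun r => (k r : ℝ))
  simp only [Pi.one_apply, Finset.prod_const_one, one_mul] at htranslate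
  rw [← htranslate]
  congr 1
  all_goals (ext r; rw [Pi.add_apply]; ring)

theorem latticeSum_taylor {N : ℕ} (hN : 1 ≤ N) (hf : ContDiff ℝ (N : WithTop ℕ∞) f)
    (w : Fin p → ℝ) :
    latticeSum n f w =
      (∑ d ∈ Finset.range N, ∑ α ∈ ofDegree p d,
        1 / (∏ r, ((α r).factorial : ℝ)) * latticeSum n (multiDeriv α f) 0 * ∏ r, w r ^ α r) +
      ∑ α ∈ ofDegree p N, (N : ℝ) / (∏ r, ((α r).factorial : ℝ)) *
        ∫ s in (0 : ℝ)..1, (1 - s) ^ (N - 1) *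
          ((∏ r, w r ^ α r) * latticeSum n (multiDeriv α f) (s • w)) := by
  obtain ⟨N, rfl⟩ := Nat.exists_eq_add_of_le' hN
  rw [Nat.add_sub_cancel, Nat.cast_succ]
  have htaylor (k : Fin p → ℕ) := taylor_multiDeriv hf (fun r => (k r : ℝ)) w
  rw [latticeSum, Finset.sum_congr rfl fun k _ => htaylor k, Finset.sum_add_distrib]
  congr 1
  · rw [Finset.sum_comm]
    refine Finset.sum_congr rfl fun d _ => ?_
    rw [Finset.sum_comm]
    refine Finset.sum_congr rfl fun α _ => ?_
    simp only [latticeSum, add_zero, Finset.mul_sum, Finset.sum_mul]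
    exact Finset.sum_congr rfl fun k _ => by ring
  · rw [Finset.sum_comm]
    refine Finset.sum_congr rfl fun α hα => ?_
    have := continuous_multiDeriv hf (mem_ofDegree.1 hα).le
    rw [← Finset.mul_sum, ← intervalIntegral.integral_finsetSum fun k _ =>
      Continuous.intervalIntegrable (by fun_prop) _ _]
    simp only [latticeSum, Finset.mul_sum]

theorem prod_div_two_mul_monomial (j α : Fin p → ℕ) :
    (∏ r, (j r : ℝ) / 2) * ∏ r, ((j r : ℝ) / 2) ^ α r =
      (2 ^ (∑ r, α r + p))⁻¹ * ∏ r, (j r : ℝ) ^ (α r + 1) := by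
  simp only [← Finset.prod_mul_distrib, ← pow_succ']
  simp only [div_pow]
  rw [Finset.prod_div_distrib, Finset.prod_pow_eq_pow_sum, Finset.sum_add_distrib, inv_mul_eq_div]
  simp

theorem quad_monomial_mul_latticeSum (m : ℕ) (α : Fin p → ℕ) {g : (Fin p → ℝ) → ℝ}
    (hg : Continuous g) (s : ℝ) :
    quad m (fun w => (∏ r, w r ^ α r) * latticeSum n g (s • w)) =
      (2 ^ (∑ r, α r + p))⁻¹ * boxInt (fun _ => -1) (fun _ => 1) fun v =>
        (∏ r, v r ^ α r) * ∑ j ∈ upTo p m, gamVec m j * (∏ r, (j r : ℝ) ^ (α r + 1)) *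
          ∑ k ∈ below n, g (fun r => (k r : ℝ) + s * (j r : ℝ) * v r / 2) := by
  have := continuous_latticeSum n hg
  have hsum : ∀ (j : Fin p → ℕ) (v : Fin p → ℝ),
      latticeSum n g (s • fun r => (j r : ℝ) / 2 * v r) =
        ∑ k ∈ below n, g (fun r => (k r : ℝ) + s * (j r : ℝ) * v r / 2) := by
    refine fun j v => Finset.sum_congr rfl fun k _ => congrArg _ <| funext fun r => ?_
    simp only [Pi.add_apply, Pi.smul_apply, smul_eq_mul]
    ring
  rw [quad_eq_boxInt m (by fun_prop), ← boxInt_const_mul]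
  congr with v
  rw [Finset.mul_sum, Finset.mul_sum]
  refine Finset.sum_congr rfl fun j _ => ?_
  simp only [mul_pow, Finset.prod_mul_distrib, hsum]
  rw [← mul_assoc, mul_assoc (gamVec m j), ← mul_assoc (∏ r, (j r : ℝ) / 2),
    prod_div_two_mul_monomial]
  ring

theorem remainder_eq_sum_quad {m : ℕ} (hm : 1 ≤ m)
    (hf : ContDiff ℝ ((2 * m : ℕ) : WithTop ℕ∞) f) :
    remainder m n f = ∑ α ∈ ofDegree p (2 * m), (2 * m : ℝ) / (∏ r, ((α r).factorial : ℝ)) *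
      quad m fun w => ∫ s in (0 : ℝ)..1, (1 - s) ^ (2 * m - 1) *
        ((∏ r, w r ^ α r) * latticeSum n (multiDeriv α f) (s • w)) := by
  rw [remainder, Finset.mul_sum]
  refine Finset.sum_congr rfl fun α hα => ?_
  have hα' := mem_ofDegree.1 hα
  have hcont := continuous_multiDeriv hf hα'.le
  have := continuous_latticeSum n hcont
  rw [quad_intervalIntegral m (by unfold Function.uncurry; fun_prop)]
  simp only [quad_const_mul, quad_monomial_mul_latticeSum n m α hcont, hα',
    mul_left_comm _ (2 ^ (2 * m + p) : ℝ)⁻¹]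
  rw [intervalIntegral.integral_const_mul]
  obtain ⟨N, hN⟩ : ∃ N, 2 * m + p = N + 1 := ⟨2 * m + p - 1, by omega⟩
  rw [hN, Nat.add_sub_cancel, pow_succ, ← mul_assoc, ← mul_assoc]
  congr 1
  field_simp

theorem sum_eq_approx_sub_remainder {m : ℕ} (hm : 1 ≤ m)
    (hf : ContDiff ℝ ((2 * m : ℕ) : WithTop ℕ∞) f) :
    ∑ k ∈ below n, f (fun r => (k r : ℝ)) = approx m n f - remainder m n f := by
  have hcont : ∀ α ∈ ofDegree p (2 * m), Continuous (latticeSum n (multiDeriv α f)) := fun α hα =>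
    continuous_latticeSum n (continuous_multiDeriv hf (mem_ofDegree.1 hα).le)
  have hrem : ∀ α ∈ ofDegree p (2 * m), Continuous fun w => ∫ s in (0 : ℝ)..1,
      (1 - s) ^ (2 * m - 1) * ((∏ r, w r ^ α r) * latticeSum n (multiDeriv α f) (s • w)) := by
    intro α hα
    have := hcont α hα
    fun_prop
  rw [eq_sub_iff_add_eq, approx_eq_quad n m hf.continuous,
    funext (latticeSum_taylor n (by omega) hf),
    quad_add _ (by fun_prop) (continuous_finsetSum _ fun α hα => (hrem α hα).const_mul _),
    quad_polynomial m hm fun α =>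
      1 / (∏ r, ((α r).factorial : ℝ)) * latticeSum n (multiDeriv α f) 0,
    quad_finsetSum _ _ fun α hα => (hrem α hα).const_mul _, remainder_eq_sum_quad n hm hf]
  simp only [quad_const_mul, multiDeriv_zero, latticeSum, Pi.zero_apply, Nat.factorial_zero,
    add_zero]
  simp

end

/-! ### The remainder bound -/

theorem integral_neg_self_abs_pow (e : ℕ) {a : ℝ} (ha : 0 ≤ a) :
    ∫ x in -a..a, |x| ^ e = 2 * a ^ (e + 1) / (e + 1) := by
  have hi (b c : ℝ) : IntervalIntegrable (fun x : ℝ => |x| ^ e) volume b c :=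
    Continuous.intervalIntegrable (by fun_prop) _ _
  have hpos : ∫ x in (0 : ℝ)..a, |x| ^ e = a ^ (e + 1) / (e + 1) := by
    rw [intervalIntegral.integral_congr (g := fun x : ℝ => x ^ e)]
    · simp [integral_pow]
    · intro x hx
      rw [Set.uIcc_of_le ha] at hx
      simp [abs_of_nonneg hx.1]
  have hneg : ∫ x in -a..0, |x| ^ e = a ^ (e + 1) / (e + 1) := by
    rw [← hpos, ← neg_zero, ← intervalIntegral.integral_comp_neg]
    simp only [abs_neg, neg_zero]
  rw [← intervalIntegral.integral_add_adjacent_intervals (hi (-a) 0) (hi 0 a), hpos, hneg]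
  ring

theorem abs_integral_one_sub_pow_mul_le {N : ℕ} (hN : 1 ≤ N) {h : ℝ → ℝ} {C : ℝ}
    (hC : ∀ s ∈ Set.Icc (0 : ℝ) 1, |h s| ≤ C) :
    |∫ s in (0 : ℝ)..1, (1 - s) ^ (N - 1) * h s| ≤ C / N := by
  have hint : ∫ s in (0 : ℝ)..1, (1 - s) ^ (N - 1) * C = C / N := by
    rw [intervalIntegral.integral_mul_const,
      intervalIntegral.integral_comp_sub_left (fun x : ℝ => x ^ (N - 1)), integral_pow,
      ← Nat.cast_succ, Nat.succ_eq_add_one, Nat.sub_add_cancel hN]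
    simp [div_eq_inv_mul, Nat.one_le_iff_ne_zero.1 hN]
  rw [← hint, ← Real.norm_eq_abs]
  have hcont : Continuous fun s : ℝ => (1 - s) ^ (N - 1) * C := by fun_prop
  refine intervalIntegral.norm_integral_le_of_norm_le zero_le_one
    (.of_forall fun s hs => ?_) (hcont.intervalIntegrable _ _)
  have hs' : 0 ≤ (1 - s) ^ (N - 1) := pow_nonneg (sub_nonneg.2 hs.2) _
  rw [Real.norm_eq_abs, abs_mul, abs_of_nonneg hs']
  exact mul_le_mul_of_nonneg_left (hC s (Set.Ioc_subset_Icc_self hs)) hs'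

section

variable {p : ℕ}

theorem abs_boxInt_le {u v : Fin p → ℝ} (huv : u ≤ v) {g h : (Fin p → ℝ) → ℝ}
    (hg : Continuous g) (hgh : ∀ w ∈ Set.Icc u v, |h w| ≤ g w) :
    |boxInt u v h| ≤ boxInt u v g := by
  rw [boxInt_of_le _ huv, boxInt_of_le _ huv]
  exact norm_integral_le_of_norm_le (hg.continuousOn.integrableOn_compact isCompact_Icc)
    ((ae_restrict_iff' measurableSet_Icc).2 (.of_forall fun w hw =>
      (Real.norm_eq_abs _).trans_le (hgh w hw)))

theorem abs_quad_le {m : ℕ} {g : (Fin p → ℝ) → ℝ} {α : Fin p → ℕ} {C : ℝ}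
    (hg : ∀ w : Fin p → ℝ, (∀ r, |w r| ≤ (m : ℝ) / 2) → |g w| ≤ C * ∏ r, |w r| ^ α r) :
    |quad m g| ≤
      C * ∑ j ∈ upTo p m, |gamVec m j| * ∏ r, 2 * ((j r : ℝ) / 2) ^ (α r + 1) / (α r + 1) := by
  rw [Finset.mul_sum]
  refine (Finset.abs_sum_le_sum_abs _ _).trans (Finset.sum_le_sum fun j hj => ?_)
  have hj2 (r) : (j r : ℝ) ≤ m := Nat.cast_le.2 (mem_upTo.1 hj r).2
  rw [abs_mul, mul_left_comm]
  refine mul_le_mul_of_nonneg_left ?_ (abs_nonneg _)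
  calc |boxInt (fun r => -(j r : ℝ) / 2) (fun r => (j r : ℝ) / 2) g|
      ≤ boxInt (fun r => -(j r : ℝ) / 2) (fun r => (j r : ℝ) / 2)
          fun w => C * ∏ r, |w r| ^ α r := by
        refine abs_boxInt_le (fun r => by dsimp only; linarith [(j r).cast_nonneg (α := ℝ)])
          (by fun_prop) fun w hw => hg w fun r => abs_le.2 ⟨?_, ?_⟩
        · linarith [hw.1 r, hj2 r]
        · linarith [hw.2 r, hj2 r]
    _ = C * ∏ r, 2 * ((j r : ℝ) / 2) ^ (α r + 1) / (α r + 1) := by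
        rw [boxInt_const_mul, boxInt_prod _ _ fun r x => |x| ^ α r]
        simp only [neg_div]
        simp only [integral_neg_self_abs_pow _ (div_nonneg (Nat.cast_nonneg _) zero_le_two)]

theorem abs_le_of_abs_le_on_Ioc {ι : Type*} {a b : ι → ℝ} (hab : ∀ r, a r < b r)
    {g : (ι → ℝ) → ℝ} (hg : Continuous g) {M : ℝ}
    (hM : ∀ u : ι → ℝ, (∀ r, a r < u r ∧ u r ≤ b r) → |g u| ≤ M) {u : ι → ℝ}
    (hu : ∀ r, u r ∈ Set.Icc (a r) (b r)) : |g u| ≤ M := by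
  have hclosed : IsClosed {u | |g u| ≤ M} := isClosed_le hg.abs continuous_const
  have hsub : (Set.univ.pi fun r => Set.Ioc (a r) (b r)) ⊆ {u | |g u| ≤ M} :=
    fun u hu => hM u fun r => hu r (Set.mem_univ r)
  refine closure_minimal hsub hclosed ?_
  rw [closure_pi_set]
  intro r _
  beta_reduce
  rw [closure_Ioc (hab r).ne]
  exact hu r

theorem prod_two_mul_half_pow_div (x : Fin p → ℝ) (α : Fin p → ℕ) :
    ∏ r, 2 * (x r / 2) ^ (α r + 1) / (α r + 1) =
      (2 ^ ∑ r, α r)⁻¹ * (∏ r, ((α r : ℝ) + 1))⁻¹ * ∏ r, x r ^ (α r + 1) := by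
  have hfactor (r) : 2 * (x r / 2) ^ (α r + 1) / (α r + 1) =
      (2 ^ α r)⁻¹ * ((α r : ℝ) + 1)⁻¹ * x r ^ (α r + 1) := by
    rw [div_pow, pow_succ 2]
    field_simp
  simp only [hfactor, Finset.prod_mul_distrib, Finset.prod_inv_distrib, Finset.prod_pow_eq_pow_sum]

theorem abs_remainder_le {m : ℕ} (hm : 1 ≤ m) (n : Fin p → ℕ) {f : (Fin p → ℝ) → ℝ}
    (hf : ContDiff ℝ ((2 * m : ℕ) : WithTop ℕ∞) f) {M : ℝ}
    (hM : ∀ α : Fin p → ℕ, ∑ r, α r = 2 * m →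
        ∀ u : Fin p → ℝ, (∀ r, -(m : ℝ) / 2 < u r ∧ u r ≤ (m : ℝ) / 2) →
          |latticeSum n (multiDeriv α f) u| ≤ M) :
    |remainder m n f| ≤ remainderBound p m M := by
  have hm0 : (0 : ℝ) < m := Nat.cast_pos.2 hm
  have hquad : ∀ α ∈ ofDegree p (2 * m), |quad m fun w => ∫ s in (0 : ℝ)..1,
      (1 - s) ^ (2 * m - 1) * ((∏ r, w r ^ α r) * latticeSum n (multiDeriv α f) (s • w))| ≤
      M / (2 * m) *
        ∑ j ∈ upTo p m, |gamVec m j| * ∏ r, 2 * ((j r : ℝ) / 2) ^ (α r + 1) / (α r + 1) := by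
    intro α hα
    have hcont := continuous_latticeSum n (continuous_multiDeriv hf (mem_ofDegree.1 hα).le)
    refine abs_quad_le fun w hw => ?_
    have hbound := abs_integral_one_sub_pow_mul_le (N := 2 * m) (by omega)
      (h := fun s => (∏ r, w r ^ α r) * latticeSum n (multiDeriv α f) (s • w))
      (C := (∏ r, |w r| ^ α r) * M) fun s hs => ?_
    · rwa [mul_comm (∏ _, _) M, mul_div_right_comm, Nat.cast_mul, Nat.cast_ofNat] at hbound
    simp only [abs_mul, Finset.abs_prod, abs_pow]
    refine mul_le_mul_of_nonneg_left ?_ (by positivity)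
    refine abs_le_of_abs_le_on_Ioc (fun _ => by linarith) hcont (hM α (mem_ofDegree.1 hα))
      fun r => ?_
    rw [neg_div]
    refine abs_le.1 ?_
    rw [Pi.smul_apply, smul_eq_mul, abs_mul, abs_of_nonneg hs.1]
    exact (mul_le_of_le_one_left (abs_nonneg _) hs.2).trans (hw r)
  rw [remainder_eq_sum_quad n hm hf, remainderBound, Finset.mul_sum]
  refine (Finset.abs_sum_le_sum_abs _ _).trans (Finset.sum_le_sum fun α hα => ?_)
  rw [abs_mul, abs_of_nonneg (by positivity)]
  refine (mul_le_mul_of_nonneg_left (hquad α hα) (by positivity)).trans_eq ?_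
  simp only [prod_two_mul_half_pow_div, mem_ofDegree.1 hα, Nat.factorial_succ, Nat.cast_mul,
    Nat.cast_succ, Finset.prod_mul_distrib]
  simp only [mul_left_comm |gamVec m _|, ← Finset.mul_sum]
  field_simp

end

/-! ### The constants -/

/-- The logarithm of `Λ` on `(0, 1)`. -/
noncomputable def logLam (t : ℝ) : ℝ :=
  (t - 1) * Real.log (1 - t) - (1 + t) * Real.log (1 + t) + 2 * Real.log t

/-- The derivative of `logLam` on `(0, 1)`. -/
noncomputable def logDerivLam (t : ℝ) : ℝ := Real.log (1 - t) - Real.log (1 + t) + 2 / t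

theorem Lam_eq_exp {t : ℝ} (ht : t ∈ Set.Ioo (0 : ℝ) 1) : Lam t = Real.exp (logLam t) := by
  rw [Lam, logLam, Real.exp_add, Real.exp_sub, Real.rpow_def_of_pos (sub_pos.2 ht.2),
    Real.rpow_def_of_pos (by linarith [ht.1]), two_mul, Real.exp_add, Real.exp_log ht.1,
    div_eq_mul_inv, ← Real.exp_neg, sq]
  ring_nf

theorem Lam_pos {t : ℝ} (ht : t ∈ Set.Ioo (0 : ℝ) 1) : 0 < Lam t :=
  Lam_eq_exp ht ▸ Real.exp_pos _

theorem hasDerivAt_logLam {t : ℝ} (ht : t ∈ Set.Ioo (0 : ℝ) 1) :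
    HasDerivAt logLam (logDerivLam t) t := by
  have hsub : 1 - t ≠ 0 := (sub_pos.2 ht.2).ne'
  have hadd : 1 + t ≠ 0 := by linarith [ht.1]
  refine (((((hasDerivAt_id t).sub_const 1).mul (((hasDerivAt_id t).const_sub 1).log hsub)).sub
    (((hasDerivAt_id t).const_add 1).mul (((hasDerivAt_id t).const_add 1).log hadd))).add
    ((Real.hasDerivAt_log ht.1.ne').const_mul 2)).congr_deriv ?_
  simp only [id, logDerivLam]
  field_simp
  ring

theorem hasDerivAt_logDerivLam {t : ℝ} (ht : t ∈ Set.Ioo (0 : ℝ) 1) :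
    HasDerivAt logDerivLam (-(2 / (1 - t ^ 2)) - 2 / t ^ 2) t := by
  have hsub : 1 - t ≠ 0 := (sub_pos.2 ht.2).ne'
  have hadd : 1 + t ≠ 0 := by linarith [ht.1]
  refine (((((hasDerivAt_id t).const_sub 1).log hsub).sub
    (((hasDerivAt_id t).const_add 1).log hadd)).add
    ((hasDerivAt_inv ht.1.ne').const_mul 2)).congr_deriv ?_
  simp only [id]
  rw [show 1 - t ^ 2 = (1 - t) * (1 + t) by ring]
  field_simp
  ring

theorem eight_le_two_div_add_two_div {t : ℝ} (ht : t ∈ Set.Ioo (0 : ℝ) 1) :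
    8 ≤ 2 / (1 - t ^ 2) + 2 / t ^ 2 := by
  have hsq : 0 < t ^ 2 := pow_pos ht.1 2
  have hsub : 0 < 1 - t ^ 2 := by nlinarith [ht.1, ht.2]
  rw [div_add_div _ _ hsub.ne' hsq.ne', le_div_iff₀ (mul_pos hsub hsq)]
  nlinarith [sq_nonneg (2 * t ^ 2 - 1)]

theorem concaveOn_logLam_add : ConcaveOn ℝ (Set.Ioo 0 1) fun t => logLam t + 4 * t ^ 2 := by
  have hderiv : ∀ t ∈ Set.Ioo (0 : ℝ) 1,
      HasDerivAt (fun t => logLam t + 4 * t ^ 2) (logDerivLam t + 8 * t) t := fun t ht =>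
    ((hasDerivAt_logLam ht).add ((hasDerivAt_pow 2 t).const_mul 4)).congr_deriv (by
      norm_num
      ring)
  have hderiv2 : ∀ t ∈ Set.Ioo (0 : ℝ) 1, HasDerivAt (fun t => logDerivLam t + 8 * t)
      (-(2 / (1 - t ^ 2)) - 2 / t ^ 2 + 8) t := fun t ht =>
    ((hasDerivAt_logDerivLam ht).add ((hasDerivAt_id t).const_mul 8)).congr_deriv (by ring)
  refine concaveOn_of_hasDerivWithinAt2_nonpos (convex_Ioo 0 1)
    (f' := fun t => logDerivLam t + 8 * t)
    (f'' := fun t => -(2 / (1 - t ^ 2)) - 2 / t ^ 2 + 8)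
    (fun t ht => (hderiv t ht).continuousAt.continuousWithinAt) ?_ ?_ ?_
  all_goals rw [interior_Ioo]
  · exact fun t ht => (hderiv t ht).hasDerivWithinAt
  · exact fun t ht => (hderiv2 t ht).hasDerivWithinAt
  · intro t ht
    linarith [eight_le_two_div_add_two_div ht]

theorem le_tangent_of_concaveOn {S : Set ℝ} {f : ℝ → ℝ} (hf : ConcaveOn ℝ S f) {c t f' : ℝ}
    (hc : c ∈ S) (ht : t ∈ S) (hd : HasDerivAt f f' c) : f t ≤ f c + f' * (t - c) := by
  rcases lt_trichotomy t c with h | rfl | h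
  · have hslope := hf.le_slope_of_hasDerivAt ht hc h hd
    rw [slope_def_field, le_div_iff₀ (sub_pos.2 h)] at hslope
    linarith
  · simp
  · have hslope := hf.slope_le_of_hasDerivAt hc ht h hd
    rw [slope_def_field, div_le_iff₀ (sub_pos.2 h)] at hslope
    linarith

theorem logLam_le {c t : ℝ} (hc : c ∈ Set.Ioo (0 : ℝ) 1) (ht : t ∈ Set.Ioo (0 : ℝ) 1) :
    logLam t ≤ logLam c + logDerivLam c * (t - c) - 4 * (t - c) ^ 2 := by
  have htangent := le_tangent_of_concaveOn concaveOn_logLam_add hc ht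
    ((hasDerivAt_logLam hc).add ((hasDerivAt_pow 2 c).const_mul 4))
  norm_num at htangent
  linarith

theorem Lam_le_mul_exp {c t : ℝ} (hc : c ∈ Set.Ioo (0 : ℝ) 1) (ht : t ∈ Set.Ioo (0 : ℝ) 1) :
    Lam t ≤ Lam c * Real.exp (logDerivLam c ^ 2 / 16) := by
  rw [Lam_eq_exp ht, Lam_eq_exp hc, ← Real.exp_add, Real.exp_le_exp]
  nlinarith [logLam_le hc ht, sq_nonneg (8 * (t - c) - logDerivLam c)]

theorem log_eleven_lt : Real.log 11 < 2.4 := by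
  rw [Real.log_lt_iff_lt_exp (by norm_num)]
  refine lt_of_pow_lt_pow_left₀ 5 (Real.exp_pos _).le ?_
  calc (11 : ℝ) ^ 5 < 2.7182 ^ 12 := by norm_num
    _ ≤ Real.exp 1 ^ 12 := by
      gcongr
      linarith [Real.exp_one_gt_d9]
    _ = Real.exp 2.4 ^ 5 := by
      rw [← Real.exp_nat_mul, ← Real.exp_nat_mul]
      norm_num

theorem lt_log_eleven : 2.38 < Real.log 11 := by
  rw [Real.lt_log_iff_exp_lt (by norm_num)]
  refine lt_of_pow_lt_pow_left₀ 50 (by norm_num) ?_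
  calc Real.exp 2.38 ^ 50 = Real.exp 1 ^ 119 := by
        rw [← Real.exp_nat_mul, ← Real.exp_nat_mul]
        norm_num
    _ ≤ 2.7183 ^ 119 := by
      gcongr
      linarith [Real.exp_one_lt_d9]
    _ < (11 : ℝ) ^ 50 := by norm_num

-- `5 / 6` is a rational approximation of the maximizer `0.8336…` of `Λ`.
theorem five_sixths_mem_Ioo : (5 / 6 : ℝ) ∈ Set.Ioo (0 : ℝ) 1 := by norm_num

theorem logDerivLam_five_sixths : logDerivLam (5 / 6) = 2.4 - Real.log 11 := by
  rw [logDerivLam, ← Real.log_div (by norm_num) (by norm_num),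
    show (1 - 5 / 6 : ℝ) / (1 + 5 / 6) = 11⁻¹ by norm_num, Real.log_inv]
  norm_num
  ring

theorem Lam_five_sixths_pow : Lam (5 / 6) ^ 6 = 25 ^ 6 / 11 ^ 11 := by
  have hlog : logLam (5 / 6) = 2 * Real.log 5 - 11 / 6 * Real.log 11 := by
    rw [logLam, show (1 - 5 / 6 : ℝ) = 1 / 6 by norm_num,
      show (1 + 5 / 6 : ℝ) = 11 / 6 by norm_num, Real.log_div (by norm_num) (by norm_num),
      Real.log_div (by norm_num) (by norm_num), Real.log_div (by norm_num) (by norm_num),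
      Real.log_one]
    ring
  rw [Lam_eq_exp five_sixths_mem_Ioo, ← Real.exp_nat_mul, hlog,
    show ((6 : ℕ) : ℝ) * (2 * Real.log 5 - 11 / 6 * Real.log 11) =
      (12 : ℕ) * Real.log 5 - (11 : ℕ) * Real.log 11 by push_cast; ring,
    Real.exp_sub, Real.exp_nat_mul, Real.exp_nat_mul, Real.exp_log (by norm_num),
    Real.exp_log (by norm_num)]
  norm_num

theorem exists_logDerivLam_eq_zero : ∃ c ∈ Set.Ioo (0 : ℝ) 1, logDerivLam c = 0 := by
  have hcont : ContinuousOn logDerivLam (Set.Icc (5 / 6) (9 / 10)) := fun t ht =>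
    (hasDerivAt_logDerivLam
      ⟨by linarith [ht.1], by linarith [ht.2]⟩).continuousAt.continuousWithinAt
  have hleft : 0 ≤ logDerivLam (5 / 6) := by
    rw [logDerivLam_five_sixths]
    linarith [log_eleven_lt]
  have hright : logDerivLam (9 / 10) ≤ 0 := by
    have hlog : 2.38 < Real.log 19 :=
      lt_log_eleven.trans (Real.log_lt_log (by norm_num) (by norm_num))
    rw [logDerivLam, ← Real.log_div (by norm_num) (by norm_num),
      show (1 - 9 / 10 : ℝ) / (1 + 9 / 10) = 19⁻¹ by norm_num, Real.log_inv]
    linarith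
  obtain ⟨c, hc, hzero⟩ := intermediate_value_Icc' (by norm_num) hcont ⟨hright, hleft⟩
  exact ⟨c, ⟨by linarith [hc.1], by linarith [hc.2]⟩, hzero⟩

theorem isGreatest_LamStar : IsGreatest (Lam '' Set.Ioo 0 1) LamStar := by
  obtain ⟨c, hc, hzero⟩ := exists_logDerivLam_eq_zero
  have hgreatest : IsGreatest (Lam '' Set.Ioo 0 1) (Lam c) := by
    refine ⟨⟨c, hc, rfl⟩, ?_⟩
    rintro _ ⟨t, ht, rfl⟩
    simpa [hzero] using Lam_le_mul_exp hc ht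
  rw [LamStar, hgreatest.csSup_eq]
  exact hgreatest

theorem Lam_le_LamStar {t : ℝ} (ht : t ∈ Set.Ioo (0 : ℝ) 1) : Lam t ≤ LamStar :=
  isGreatest_LamStar.2 ⟨t, ht, rfl⟩

theorem lt_LamStar : 0.30812 < LamStar := by
  refine lt_of_lt_of_le ?_ (Lam_le_LamStar five_sixths_mem_Ioo)
  refine lt_of_pow_lt_pow_left₀ 6 (Lam_pos five_sixths_mem_Ioo).le ?_
  rw [Lam_five_sixths_pow]
  norm_num

theorem LamStar_lt : LamStar < 0.30813 := by
  obtain ⟨t, ht, heq⟩ := isGreatest_LamStar.1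
  have hderiv : logDerivLam (5 / 6) ^ 2 / 16 ≤ 1 / 40000 := by
    have hsq : logDerivLam (5 / 6) ^ 2 ≤ 0.02 ^ 2 := by
      rw [logDerivLam_five_sixths]
      exact pow_le_pow_left₀ (by linarith [log_eleven_lt]) (by linarith [lt_log_eleven]) 2
    linarith
  have hLam : Lam (5 / 6) < 0.308121 := by
    refine lt_of_pow_lt_pow_left₀ 6 (by norm_num) ?_
    rw [Lam_five_sixths_pow]
    norm_num
  calc LamStar ≤ Lam (5 / 6) * Real.exp (logDerivLam (5 / 6) ^ 2 / 16) :=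
        heq ▸ Lam_le_mul_exp five_sixths_mem_Ioo ht
    _ ≤ 0.308121 * (1 / (1 - 1 / 40000)) := by
        gcongr
        exact (Real.exp_le_exp.2 hderiv).trans
          (Real.exp_bound_div_one_sub_of_interval (by norm_num) (by norm_num))
    _ < 0.30813 := by norm_num

theorem LamStar_pos : 0 < LamStar := lt_trans (by norm_num) lt_LamStar

theorem lt_kap : 0.27754 < kap := by
  rw [kap, Real.lt_sqrt (by norm_num)]
  linarith [lt_LamStar]

theorem kap_lt : kap < 0.27755 := by
  rw [kap, Real.sqrt_lt' (by norm_num)]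
  linarith [LamStar_lt]

/-! ### Ratios of binomial coefficients -/

section

open Stirling

theorem antitone_log_stirlingSeq_sub :
    Antitone fun n : ℕ => Real.log (stirlingSeq (n + 1)) - Real.log (stirlingSeq (n + 2)) := by
  intro a b hab
  refine hasSum_le (fun k => ?_) (log_stirlingSeq_sdiff_hasSum b) (log_stirlingSeq_sdiff_hasSum a)
  push_cast
  gcongr

theorem two_mul_log_stirlingSeq_le {m j : ℕ} (h : j < m) :
    2 * Real.log (stirlingSeq m) ≤
      Real.log (stirlingSeq (m + j)) + Real.log (stirlingSeq (m - j)) := by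
  induction j with
  | zero => simp [two_mul]
  | succ j ih =>
    have hanti := antitone_log_stirlingSeq_sub (by omega : m - j - 2 ≤ m + j - 1)
    simp only [show m - j - 2 + 1 = m - (j + 1) by omega, show m - j - 2 + 2 = m - j by omega,
      show m + j - 1 + 1 = m + j by omega, show m + j - 1 + 2 = m + (j + 1) by omega] at hanti
    linarith [ih (by omega)]

theorem stirlingSeq_pos {n : ℕ} (hn : n ≠ 0) : 0 < stirlingSeq n := by
  obtain ⟨k, rfl⟩ := Nat.exists_eq_succ_of_ne_zero hn
  exact stirlingSeq'_pos k

theorem stirlingSeq_sq_le {m j : ℕ} (h : j < m) :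
    stirlingSeq m ^ 2 ≤ stirlingSeq (m + j) * stirlingSeq (m - j) := by
  have hmid := stirlingSeq_pos (n := m) (by omega)
  have hadd := stirlingSeq_pos (n := m + j) (by omega)
  have hsub := stirlingSeq_pos (n := m - j) (by omega)
  rw [← Real.log_le_log_iff (pow_pos hmid 2) (mul_pos hadd hsub), Real.log_pow,
    Real.log_mul hadd.ne' hsub.ne']
  exact two_mul_log_stirlingSeq_le h

/-- The approximation of `n!` up to a constant factor that `Stirling.stirlingSeq n` compares to
`n!`. -/
noncomputable def stirlingApprox (n : ℕ) : ℝ := √(2 * n) * (n / Real.exp 1) ^ n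

theorem stirlingApprox_pos {n : ℕ} (hn : n ≠ 0) : 0 < stirlingApprox n := by
  have : (0 : ℝ) < n := Nat.cast_pos.2 (Nat.pos_of_ne_zero hn)
  unfold stirlingApprox
  positivity

theorem factorial_eq_stirlingSeq_mul {n : ℕ} (hn : n ≠ 0) :
    (n.factorial : ℝ) = stirlingSeq n * stirlingApprox n :=
  (div_mul_cancel₀ _ (stirlingApprox_pos hn).ne').symm

theorem factorial_sq_div_le {m j : ℕ} (h : j < m) :
    (m.factorial : ℝ) ^ 2 / ((m + j).factorial * (m - j).factorial) ≤
      stirlingApprox m ^ 2 / (stirlingApprox (m + j) * stirlingApprox (m - j)) := by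
  have hadd : m + j ≠ 0 := by omega
  have hsub : m - j ≠ 0 := by omega
  have := stirlingSeq_pos hadd
  have := stirlingSeq_pos hsub
  have := stirlingApprox_pos hadd
  have := stirlingApprox_pos hsub
  rw [factorial_eq_stirlingSeq_mul (n := m) (by omega), factorial_eq_stirlingSeq_mul hadd,
    factorial_eq_stirlingSeq_mul hsub, mul_pow, mul_mul_mul_comm, mul_div_mul_comm]
  refine mul_le_of_le_one_left (by positivity) ?_
  exact div_le_one_of_le₀ (stirlingSeq_sq_le h) (by positivity)

end

theorem choose_add_div_choose {m j : ℕ} (h : j ≤ m) :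
    ((2 * m).choose (m + j) : ℝ) / ((2 * m).choose m : ℝ) =
      (m.factorial : ℝ) ^ 2 / ((m + j).factorial * (m - j).factorial) := by
  rw [Nat.cast_choose ℝ (by omega : m + j ≤ 2 * m), Nat.cast_choose ℝ (by omega : m ≤ 2 * m),
    show 2 * m - (m + j) = m - j by omega, show 2 * m - m = m by omega]
  field_simp

theorem stirlingApprox_sq_div {m j : ℕ} (h : j < m) :
    stirlingApprox m ^ 2 / (stirlingApprox (m + j) * stirlingApprox (m - j)) =
      1 / √(1 - ((j : ℝ) / m) ^ 2) *
        ((m : ℝ) ^ (2 * m) / (((m : ℝ) + j) ^ (m + j) * ((m : ℝ) - j) ^ (m - j))) := by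
  have hm : (0 : ℝ) < m := Nat.cast_pos.2 (by omega)
  have hsub : (0 : ℝ) < (m : ℝ) - j := sub_pos.2 (Nat.cast_lt.2 h)
  have hroot : √(2 * ((m : ℝ) + j)) * √(2 * ((m : ℝ) - j)) =
      √(2 * m) ^ 2 * √(1 - ((j : ℝ) / m) ^ 2) := by
    rw [← Real.sqrt_mul (by positivity), Real.sq_sqrt (by positivity),
      ← Real.sqrt_sq (by positivity : (0 : ℝ) ≤ 2 * m), ← Real.sqrt_mul (by positivity)]
    congr 1
    field_simp
    ring
  have hexp : Real.exp 1 ^ (m + j) * Real.exp 1 ^ (m - j) = Real.exp 1 ^ (2 * m) := by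
    rw [← pow_add]
    congr 1
    omega
  simp only [stirlingApprox, Nat.cast_sub h.le, Nat.cast_add]
  rw [mul_mul_mul_comm, hroot]
  generalize √(1 - ((j : ℝ) / m) ^ 2) = s
  simp only [div_pow, mul_pow, ← pow_mul, mul_comm m 2, ← hexp]
  field_simp

theorem Lam_pow {m j : ℕ} (hj : 0 < j) (h : j < m) :
    Lam ((j : ℝ) / m) ^ m = (m : ℝ) ^ (2 * m) / (((m : ℝ) + j) ^ (m + j) *
      ((m : ℝ) - j) ^ (m - j)) * ((j : ℝ) / m) ^ (2 * m) := by
  have hm : (0 : ℝ) < m := Nat.cast_pos.2 (by omega)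
  have : (0 : ℝ) < j := Nat.cast_pos.2 hj
  have hsub : (0 : ℝ) < (m : ℝ) - j := sub_pos.2 (Nat.cast_lt.2 h)
  have hleft : ((1 - (j : ℝ) / m) ^ ((j : ℝ) / m - 1)) ^ m =
      ((((m : ℝ) - j) / m) ^ (m - j))⁻¹ := by
    rw [one_sub_div hm.ne', ← Real.rpow_mul_natCast (by positivity), ← Real.rpow_natCast _ (m - j),
      ← Real.rpow_neg (by positivity), Nat.cast_sub h.le]
    congr 1
    field_simp
    ring
  have hright : ((1 + (j : ℝ) / m) ^ (-1 - (j : ℝ) / m)) ^ m =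
      ((((m : ℝ) + j) / m) ^ (m + j))⁻¹ := by
    rw [one_add_div hm.ne', ← Real.rpow_mul_natCast (by positivity), ← Real.rpow_natCast _ (m + j),
      ← Real.rpow_neg (by positivity), Nat.cast_add]
    congr 1
    field_simp
    ring
  have hpow : (m : ℝ) ^ (2 * m) = (m : ℝ) ^ (m - j) * (m : ℝ) ^ (m + j) := by
    rw [← pow_add]
    congr 1
    omega
  rw [Lam, mul_pow, mul_pow, hleft, hright, ← pow_mul, hpow, div_pow, div_pow, inv_div, inv_div,
    div_mul_div_comm, mul_comm (((m : ℝ) - j) ^ (m - j))]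

theorem choose_add_div_choose_mul_pow_le {m j : ℕ} (hj : 0 < j) (h : j < m) :
    ((2 * m).choose (m + j) : ℝ) / ((2 * m).choose m : ℝ) * ((j : ℝ) / m) ^ (2 * m) ≤
      LamStar ^ m * (1 / √(1 - ((j : ℝ) / m) ^ 2)) := by
  have hm : (0 : ℝ) < m := Nat.cast_pos.2 (by omega)
  have ht : (j : ℝ) / m ∈ Set.Ioo (0 : ℝ) 1 :=
    ⟨div_pos (Nat.cast_pos.2 hj) hm, (div_lt_one hm).2 (Nat.cast_lt.2 h)⟩
  calc ((2 * m).choose (m + j) : ℝ) / ((2 * m).choose m : ℝ) * ((j : ℝ) / m) ^ (2 * m)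
      ≤ 1 / √(1 - ((j : ℝ) / m) ^ 2) *
          ((m : ℝ) ^ (2 * m) / (((m : ℝ) + j) ^ (m + j) * ((m : ℝ) - j) ^ (m - j))) *
            ((j : ℝ) / m) ^ (2 * m) := by
        gcongr
        rw [choose_add_div_choose h.le, ← stirlingApprox_sq_div h]
        exact factorial_sq_div_le h
    _ = Lam ((j : ℝ) / m) ^ m * (1 / √(1 - ((j : ℝ) / m) ^ 2)) := by
        rw [Lam_pow hj h, mul_assoc, mul_comm]
    _ ≤ LamStar ^ m * (1 / √(1 - ((j : ℝ) / m) ^ 2)) := by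
        gcongr
        · exact (Lam_pos ht).le
        · exact Lam_le_LamStar ht

theorem div_sqrt_le_arcsin_sub {a b : ℝ} (ha : 0 ≤ a) (hab : a ≤ b) (hb : b ≤ 1) (ha1 : a < 1) :
    (b - a) * (1 / √(1 - a ^ 2)) ≤ Real.arcsin b - Real.arcsin a := by
  set x := Real.arcsin a
  set y := Real.arcsin b
  have hsin_x : Real.sin x = a := Real.sin_arcsin (by linarith) (by linarith)
  have hsin_y : Real.sin y = b := Real.sin_arcsin (by linarith) hb
  have hcos_x : Real.cos x = √(1 - a ^ 2) := Real.cos_arcsin a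
  have hpos : 0 < √(1 - a ^ 2) := Real.sqrt_pos.2 (by nlinarith)
  have hadd : b = a * Real.cos (y - x) + √(1 - a ^ 2) * Real.sin (y - x) := by
    rw [← hcos_x, ← hsin_y, ← add_sub_cancel x y, Real.sin_add, hsin_x, add_sub_cancel_left]
  have hsin_le : Real.sin (y - x) ≤ y - x := Real.sin_le (sub_nonneg.2 (Real.monotone_arcsin hab))
  rw [mul_one_div, div_le_iff₀ hpos]
  nlinarith [Real.cos_le_one (y - x)]

theorem sum_inv_sqrt_le {m : ℕ} (hm : 0 < m) :
    ∑ j ∈ Finset.range m, 1 / √(1 - ((j : ℝ) / m) ^ 2) ≤ m * (Real.pi / 2) := by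
  have hm' : (0 : ℝ) < m := Nat.cast_pos.2 hm
  have hterm : ∀ j ∈ Finset.range m, 1 / √(1 - ((j : ℝ) / m) ^ 2) ≤
      m * (Real.arcsin (((j + 1 : ℕ) : ℝ) / m) - Real.arcsin ((j : ℝ) / m)) := by
    intro j hj
    rw [Finset.mem_range] at hj
    have harcsin := div_sqrt_le_arcsin_sub (a := (j : ℝ) / m) (b := ((j + 1 : ℕ) : ℝ) / m)
      (by positivity) (by gcongr; omega) ((div_le_one hm').2 (Nat.cast_le.2 hj))
      ((div_lt_one hm').2 (Nat.cast_lt.2 hj))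
    rw [Nat.cast_succ] at harcsin ⊢
    rwa [← sub_div, add_sub_cancel_left, one_div_mul_eq_div, div_le_iff₀' hm'] at harcsin
  refine (Finset.sum_le_sum hterm).trans_eq ?_
  rw [← Finset.mul_sum, Finset.sum_range_sub (fun j : ℕ => Real.arcsin ((j : ℝ) / m))]
  simp [hm'.ne']

/-! ### Moments of the weights -/

theorem one_le_choose_mul_pow {m : ℕ} (hm : 8 ≤ m) :
    1 ≤ ((2 * m).choose m : ℝ) * (0.308 : ℝ) ^ m := by
  induction m, hm using Nat.le_induction with
  | base => norm_num [Nat.choose]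
  | succ m hm ih =>
    have hrec : ((m : ℝ) + 1) * ((2 * (m + 1)).choose (m + 1) : ℝ) =
        2 * (2 * m + 1) * ((2 * m).choose m : ℝ) := by
      exact_mod_cast Nat.succ_mul_centralBinom_succ m
    have hm' : (8 : ℝ) ≤ m := by exact_mod_cast hm
    refine le_of_mul_le_mul_left ?_ (by positivity : (0 : ℝ) < (m : ℝ) + 1)
    calc ((m : ℝ) + 1) * 1
        ≤ 0.308 * (2 * (2 * m + 1)) * 1 := by linarith
      _ ≤ 0.308 * (2 * (2 * m + 1)) * (((2 * m).choose m : ℝ) * (0.308 : ℝ) ^ m) := by gcongr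
      _ = ((m : ℝ) + 1) * (((2 * (m + 1)).choose (m + 1) : ℝ) * (0.308 : ℝ) ^ (m + 1)) := by
          rw [← mul_assoc ((m : ℝ) + 1), hrec]
          ring

theorem one_le_choose_mul_LamStar_pow {m : ℕ} (hm : 8 ≤ m) :
    1 ≤ ((2 * m).choose m : ℝ) * LamStar ^ m := by
  refine (one_le_choose_mul_pow hm).trans ?_
  gcongr
  linarith [lt_LamStar]

theorem abs_gam_mul_self {m j : ℕ} (hj : 1 ≤ j) :
    |gam m j| * (j : ℝ) = 2 * (((2 * m).choose (m + j) : ℝ) / ((2 * m).choose m : ℝ)) := by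
  rw [← Nat.abs_cast (R := ℝ) j, ← abs_mul, gam_mul_self hj, abs_div, abs_mul, abs_mul,
    abs_neg_one_pow, Nat.abs_cast, Nat.abs_cast, abs_two, mul_one, mul_div_assoc]

/-- The `2m`-th moment of the weights `|γ_{m,j}| j` after scaling `j` by `m`; the closed-form
bound amounts to comparing it with `π m Λ_* ^ m`. -/
noncomputable def scaledMoment (m : ℕ) : ℝ :=
  ∑ j ∈ Finset.Icc 1 m, |gam m j| * j * ((j : ℝ) / m) ^ (2 * m)

theorem scaledMoment_eq (m : ℕ) : scaledMoment m =
    2 * ∑ j ∈ Finset.Icc 1 m, ((2 * m).choose (m + j) : ℝ) / ((2 * m).choose m : ℝ) *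
      ((j : ℝ) / m) ^ (2 * m) := by
  rw [scaledMoment, Finset.mul_sum]
  refine Finset.sum_congr rfl fun j hj => ?_
  rw [abs_gam_mul_self (Finset.mem_Icc.1 hj).1, mul_assoc]

theorem scaledMoment_le_of_eight_le {m : ℕ} (hm : 8 ≤ m) :
    scaledMoment m ≤ Real.pi * m * LamStar ^ m := by
  have hm' : (m : ℝ) ≠ 0 := by positivity
  have hchoose : (0 : ℝ) < ((2 * m).choose m : ℝ) := Nat.cast_pos.2 (Nat.choose_pos (by omega))
  have := LamStar_pos
  set w : ℕ → ℝ := fun j => 1 / √(1 - ((j : ℝ) / m) ^ 2) with hw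
  have hbelow : ∀ j ∈ Finset.Ico 1 m, ((2 * m).choose (m + j) : ℝ) / ((2 * m).choose m : ℝ) *
      ((j : ℝ) / m) ^ (2 * m) ≤ LamStar ^ m * w j := fun j hj =>
    choose_add_div_choose_mul_pow_le (Finset.mem_Ico.1 hj).1 (Finset.mem_Ico.1 hj).2
  have hlast : ((2 * m).choose (m + m) : ℝ) / ((2 * m).choose m : ℝ) *
      ((m : ℝ) / m) ^ (2 * m) ≤ LamStar ^ m * w 0 := by
    rw [← two_mul, Nat.choose_self, div_self hm', one_pow, mul_one, Nat.cast_one,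
      div_le_iff₀ hchoose]
    simpa [hw, mul_comm] using one_le_choose_mul_LamStar_pow hm
  rw [scaledMoment_eq, ← Finset.sum_Ico_add_eq_sum_Icc (by omega : 1 ≤ m)]
  calc 2 * (∑ j ∈ Finset.Ico 1 m, ((2 * m).choose (m + j) : ℝ) / ((2 * m).choose m : ℝ) *
          ((j : ℝ) / m) ^ (2 * m) +
        ((2 * m).choose (m + m) : ℝ) / ((2 * m).choose m : ℝ) * ((m : ℝ) / m) ^ (2 * m))
      ≤ 2 * (∑ j ∈ Finset.Ico 1 m, LamStar ^ m * w j + LamStar ^ m * w 0) :=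
        mul_le_mul_of_nonneg_left (add_le_add (Finset.sum_le_sum hbelow) hlast) zero_le_two
    _ = 2 * LamStar ^ m * ∑ j ∈ Finset.range m, w j := by
        rw [Finset.sum_range_eq_add_Ico w (by omega), ← Finset.mul_sum]
        ring
    _ ≤ 2 * LamStar ^ m * (m * (Real.pi / 2)) := by
        gcongr
        exact sum_inv_sqrt_le (by omega)
    _ = Real.pi * m * LamStar ^ m := by ring

theorem scaledMoment_le_of_two_le {m : ℕ} (hm : 2 ≤ m) :
    scaledMoment m ≤ Real.pi * m * LamStar ^ m := by
  rcases le_or_gt 8 m with h | h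
  · exact scaledMoment_le_of_eight_le h
  suffices hsmall : scaledMoment m ≤ 3 * m * (0.308 : ℝ) ^ m by
    refine hsmall.trans ?_
    gcongr
    · exact Real.pi_gt_three.le
    · linarith [lt_LamStar]
  rw [scaledMoment_eq]
  interval_cases m <;> norm_num [Finset.sum_Icc_succ_top, Nat.choose]

theorem scaledMoment_one : scaledMoment 1 = 1 := by
  norm_num [scaledMoment_eq, Nat.choose]

theorem scaledMoment_le_mul_of_two_le {m : ℕ} (hm : 2 ≤ m) {C : ℝ} (hC : 1 ≤ C) :
    scaledMoment m ≤ C * (Real.pi * m * LamStar ^ m) := by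
  have := LamStar_pos
  exact (scaledMoment_le_of_two_le hm).trans (le_mul_of_one_le_left (by positivity) hC)

theorem scaledMoment_le_mul {m : ℕ} (hm : 1 ≤ m) :
    scaledMoment m ≤ 1.0331 * (Real.pi * m * LamStar ^ m) := by
  rcases hm.eq_or_lt with rfl | hm
  · rw [scaledMoment_one, Nat.cast_one, mul_one, pow_one]
    nlinarith [Real.pi_gt_d6, lt_LamStar]
  · exact scaledMoment_le_mul_of_two_le hm (by norm_num)

theorem four_pow_div_choose_sq_le (m : ℕ) :
    (4 ^ m / ((2 * m).choose m : ℝ)) ^ 2 ≤ Real.pi / 2 * (2 * m + 1) := by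
  have hfactorial : (4 ^ m / ((2 * m).choose m : ℝ)) ^ 2 =
      2 ^ (4 * m) * (m.factorial : ℝ) ^ 4 / ((2 * m).factorial : ℝ) ^ 2 := by
    have hfour : ((4 : ℝ) ^ m) ^ 2 = 2 ^ (4 * m) := by
      rw [← pow_mul, show (4 : ℝ) = 2 ^ 2 by norm_num, ← pow_mul]
      ring
    rw [Nat.cast_choose ℝ (by omega : m ≤ 2 * m), show 2 * m - m = m by omega, div_pow, hfour]
    field_simp
  have hwallis := Real.Wallis.W_le m
  rw [Real.Wallis.W_eq_factorial_ratio, ← div_div, div_le_iff₀ (by positivity)] at hwallis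
  exact hfactorial.trans_le hwallis

theorem four_pow_div_choose_le {m : ℕ} (hm : 1 ≤ m) :
    4 ^ m / ((2 * m).choose m : ℝ) ≤ √(Real.pi * m) + 1 := by
  have hm' : (1 : ℝ) ≤ m := Nat.one_le_cast.2 hm
  have hroot : 1 ≤ √(Real.pi * m) := Real.one_le_sqrt.2 (by nlinarith [Real.pi_gt_three])
  refine le_of_sq_le_sq ((four_pow_div_choose_sq_le m).trans ?_) (by positivity)
  rw [add_sq, Real.sq_sqrt (by positivity)]
  linarith [Real.pi_lt_four]

theorem sum_choose_add (m : ℕ) :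
    ((2 * m).choose m : ℝ) + 2 * ∑ j ∈ Finset.Icc 1 m, ((2 * m).choose (m + j) : ℝ) = 4 ^ m := by
  have hsymm : ∀ j ≤ m, (2 * m).choose (m - j) = (2 * m).choose (m + j) := fun j hj =>
    Nat.choose_symm_of_eq_add (by omega)
  have hsum := Nat.sum_range_choose (2 * m)
  rw [sum_range_two_mul_add_one_of_symm hsymm, pow_mul, smul_eq_mul] at hsum
  exact_mod_cast hsum

theorem sum_abs_gam_mul_self_le {m : ℕ} (hm : 1 ≤ m) :
    ∑ j ∈ Finset.Icc 1 m, |gam m j| * (j : ℝ) ≤ √(Real.pi * m) := by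
  have hchoose : ((2 * m).choose m : ℝ) ≠ 0 :=
    Nat.cast_ne_zero.2 (Nat.choose_pos (by omega)).ne'
  calc ∑ j ∈ Finset.Icc 1 m, |gam m j| * (j : ℝ)
      = 2 * (∑ j ∈ Finset.Icc 1 m, ((2 * m).choose (m + j) : ℝ)) / ((2 * m).choose m : ℝ) := by
        rw [Finset.sum_congr rfl fun j hj => abs_gam_mul_self (Finset.mem_Icc.1 hj).1,
          ← Finset.mul_sum, ← Finset.sum_div, mul_div_assoc]
    _ = 4 ^ m / ((2 * m).choose m : ℝ) - 1 := by
        rw [eq_sub_of_add_eq' (sum_choose_add m), sub_div, div_self hchoose]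
    _ ≤ √(Real.pi * m) := by linarith [four_pow_div_choose_le hm]

theorem sum_abs_gam_mul_self_mul_pow {m : ℕ} (hm : 1 ≤ m) :
    ∑ j ∈ Finset.Icc 1 m, |gam m j| * (j : ℝ) * (j : ℝ) ^ (2 * m) =
      (m : ℝ) ^ (2 * m) * scaledMoment m := by
  rw [scaledMoment, Finset.mul_sum]
  refine Finset.sum_congr rfl fun j _ => ?_
  rw [div_pow]
  field_simp

theorem one_add_sum_le_prod_one_add {ι R : Type*} [CommSemiring R] [PartialOrder R]
    [IsOrderedRing R] {s : Finset ι} {f : ι → R} (hf : ∀ i ∈ s, 0 ≤ f i) :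
    1 + ∑ i ∈ s, f i ≤ ∏ i ∈ s, (1 + f i) := by
  induction s using Finset.cons_induction with
  | empty => simp
  | cons a s ha ih =>
    obtain ⟨hfa, hfs⟩ := (Finset.forall_mem_cons ha _).1 hf
    rw [Finset.sum_cons, Finset.prod_cons]
    calc 1 + (f a + ∑ i ∈ s, f i)
        ≤ 1 + (f a + ∑ i ∈ s, f i) + f a * ∑ i ∈ s, f i :=
          le_add_of_nonneg_right (mul_nonneg hfa (Finset.sum_nonneg hfs))
      _ = (1 + f a) * (1 + ∑ i ∈ s, f i) := by ring
      _ ≤ (1 + f a) * ∏ i ∈ s, (1 + f i) :=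
          mul_le_mul_of_nonneg_left (ih hfs) (add_nonneg zero_le_one hfa)

/-! ### The closed-form bound -/

theorem factorial_sum_add_one_le {ι : Type*} (s : Finset ι) (α : ι → ℕ) :
    (∑ i ∈ s, α i + 1).factorial ≤
      Nat.multinomial s α * ∏ i ∈ s, (α i + 1).factorial := by
  calc (∑ i ∈ s, α i + 1).factorial
      = (1 + ∑ i ∈ s, α i) * ((∏ i ∈ s, (α i).factorial) * Nat.multinomial s α) := by
        rw [Nat.factorial_succ, Nat.multinomial_spec, add_comm]
    _ ≤ (∏ i ∈ s, (1 + α i)) * ((∏ i ∈ s, (α i).factorial) * Nat.multinomial s α) :=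
        Nat.mul_le_mul_right _ (one_add_sum_le_prod_one_add fun i _ => Nat.zero_le (α i))
    _ = Nat.multinomial s α * ∏ i ∈ s, (α i + 1).factorial := by
        simp only [Nat.factorial_succ, Finset.prod_mul_distrib, add_comm]
        ring

theorem sum_ofDegree_monomial_le {p d : ℕ} {y : Fin p → ℝ} (hy : ∀ r, 0 ≤ y r) :
    ∑ α ∈ ofDegree p d, 1 / (∏ r, ((α r + 1).factorial : ℝ)) * ∏ r, y r ^ α r ≤
      (∑ r, y r) ^ d / ((d + 1).factorial : ℝ) := by
  rw [Finset.sum_pow_eq_sum_piAntidiag, Finset.sum_div]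
  refine Finset.sum_le_sum fun α hα => ?_
  rw [mul_div_right_comm]
  refine mul_le_mul_of_nonneg_right ?_ (Finset.prod_nonneg fun r _ => pow_nonneg (hy r) _)
  rw [div_le_div_iff₀ (by positivity) (by positivity), one_mul, ← mem_ofDegree.1 hα]
  exact_mod_cast factorial_sum_add_one_le Finset.univ α

theorem sum_upTo_prod_mul_apply {p : ℕ} (m : ℕ) (c v : ℕ → ℝ) (r : Fin p) :
    ∑ j ∈ upTo p m, (∏ s, c (j s)) * v (j r) =
      (∑ j ∈ Finset.Icc 1 m, c j) ^ (p - 1) * ∑ j ∈ Finset.Icc 1 m, c j * v j := by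
  set w : Fin p → ℕ → ℝ := fun s j => c j * if s = r then v j else 1 with hw
  have hprod : ∀ j : Fin p → ℕ, (∏ s, c (j s)) * v (j r) = ∏ s, w s (j s) := fun j => by
    rw [Finset.prod_mul_distrib, Finset.prod_ite_eq' Finset.univ r]
    simp
  have hother : ∀ s ∈ Finset.univ.erase r,
      ∑ j ∈ Finset.Icc 1 m, w s j = ∑ j ∈ Finset.Icc 1 m, c j := fun s hs => by
    simp [hw, Finset.ne_of_mem_erase hs]
  simp only [hprod]
  rw [sum_upTo_prod, ← Finset.prod_erase_mul _ _ (Finset.mem_univ r),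
    Finset.prod_congr rfl hother]
  simp [hw]

theorem sum_upTo_prod_mul_sum_pow_le {p m d : ℕ} (hd : d ≠ 0) {c : ℕ → ℝ} (hc : ∀ j, 0 ≤ c j) :
    ∑ j ∈ upTo p m, (∏ r, c (j r)) * (∑ r, (j r : ℝ)) ^ d ≤
      (p : ℝ) ^ d * ((∑ j ∈ Finset.Icc 1 m, c j) ^ (p - 1) *
        ∑ j ∈ Finset.Icc 1 m, c j * (j : ℝ) ^ d) := by
  obtain ⟨N, rfl⟩ := Nat.exists_eq_succ_of_ne_zero hd
  have hpower_mean : ∀ j : Fin p → ℕ,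
      (∑ r, (j r : ℝ)) ^ (N + 1) ≤ (p : ℝ) ^ N * ∑ r, (j r : ℝ) ^ (N + 1) := fun j => by
    simpa using pow_sum_le_card_mul_sum_pow (s := Finset.univ) (f := fun r => (j r : ℝ))
      (fun r _ => Nat.cast_nonneg _) N
  calc ∑ j ∈ upTo p m, (∏ r, c (j r)) * (∑ r, (j r : ℝ)) ^ (N + 1)
      ≤ ∑ j ∈ upTo p m, (∏ r, c (j r)) * ((p : ℝ) ^ N * ∑ r, (j r : ℝ) ^ (N + 1)) :=
        Finset.sum_le_sum fun j _ => mul_le_mul_of_nonneg_left (hpower_mean j)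
          (Finset.prod_nonneg fun r _ => hc _)
    _ = (p : ℝ) ^ N * ∑ r, ∑ j ∈ upTo p m, (∏ s, c (j s)) * (j r : ℝ) ^ (N + 1) := by
        simp only [mul_left_comm _ ((p : ℝ) ^ N), ← Finset.mul_sum]
        rw [Finset.sum_comm]
        simp only [Finset.mul_sum]
    _ = (p : ℝ) ^ (N + 1) * ((∑ j ∈ Finset.Icc 1 m, c j) ^ (p - 1) *
          ∑ j ∈ Finset.Icc 1 m, c j * (j : ℝ) ^ (N + 1)) := by
        simp only [sum_upTo_prod_mul_apply m c fun j => (j : ℝ) ^ (N + 1)]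
        rw [Fin.sum_const, nsmul_eq_mul, ← mul_assoc, ← pow_succ]

theorem abs_gamVec_mul_prod_pow {p m : ℕ} (j α : Fin p → ℕ) :
    |gamVec m j| * ∏ r, (j r : ℝ) ^ (α r + 1) =
      (∏ r, |gam m (j r)| * (j r : ℝ)) * ∏ r, (j r : ℝ) ^ α r := by
  rw [gamVec, Finset.abs_prod, ← Finset.prod_mul_distrib, ← Finset.prod_mul_distrib]
  exact Finset.prod_congr rfl fun r _ => by ring

theorem sum_remainder_weights_le {p m : ℕ} (hm : 1 ≤ m) :
    ∑ α ∈ ofDegree p (2 * m), 1 / (∏ r, ((α r + 1).factorial : ℝ)) *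
      ∑ j ∈ upTo p m, |gamVec m j| * ∏ r, (j r : ℝ) ^ (α r + 1) ≤
    (p : ℝ) ^ (2 * m) * (√(Real.pi * m) ^ (p - 1) * ((m : ℝ) ^ (2 * m) * scaledMoment m)) /
      ((2 * m + 1).factorial : ℝ) := by
  set c : ℕ → ℝ := fun j => |gam m j| * j
  have hc : ∀ j, 0 ≤ c j := fun j => by positivity
  have hmoment : ∑ j ∈ Finset.Icc 1 m, c j * (j : ℝ) ^ (2 * m) =
      (m : ℝ) ^ (2 * m) * scaledMoment m := sum_abs_gam_mul_self_mul_pow hm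
  simp only [abs_gamVec_mul_prod_pow, Finset.mul_sum]
  rw [Finset.sum_comm]
  calc ∑ j ∈ upTo p m, ∑ α ∈ ofDegree p (2 * m), 1 / (∏ r, ((α r + 1).factorial : ℝ)) *
          ((∏ r, c (j r)) * ∏ r, (j r : ℝ) ^ α r)
      = ∑ j ∈ upTo p m, (∏ r, c (j r)) * ∑ α ∈ ofDegree p (2 * m),
          1 / (∏ r, ((α r + 1).factorial : ℝ)) * ∏ r, (j r : ℝ) ^ α r := by
        simp only [Finset.mul_sum, mul_left_comm]
    _ ≤ ∑ j ∈ upTo p m, (∏ r, c (j r)) * ((∑ r, (j r : ℝ)) ^ (2 * m) /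
          ((2 * m + 1).factorial : ℝ)) :=
        Finset.sum_le_sum fun j _ => mul_le_mul_of_nonneg_left
          (sum_ofDegree_monomial_le fun r => Nat.cast_nonneg _)
          (Finset.prod_nonneg fun r _ => hc _)
    _ = (∑ j ∈ upTo p m, (∏ r, c (j r)) * (∑ r, (j r : ℝ)) ^ (2 * m)) /
          ((2 * m + 1).factorial : ℝ) := by
        simp only [Finset.sum_div, mul_div_assoc]
    _ ≤ (p : ℝ) ^ (2 * m) * ((∑ j ∈ Finset.Icc 1 m, c j) ^ (p - 1) *
          ∑ j ∈ Finset.Icc 1 m, c j * (j : ℝ) ^ (2 * m)) / ((2 * m + 1).factorial : ℝ) := by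
        gcongr
        exact sum_upTo_prod_mul_sum_pow_le (by omega) hc
    _ ≤ (p : ℝ) ^ (2 * m) * (√(Real.pi * m) ^ (p - 1) * ((m : ℝ) ^ (2 * m) * scaledMoment m)) /
          ((2 * m + 1).factorial : ℝ) := by
        have : 0 ≤ ∑ j ∈ Finset.Icc 1 m, c j * (j : ℝ) ^ (2 * m) :=
          Finset.sum_nonneg fun j _ => mul_nonneg (hc j) (by positivity)
        rw [← hmoment]
        gcongr
        exact sum_abs_gam_mul_self_le hm

theorem kap_pow_two_mul (m : ℕ) : kap ^ (2 * m) = LamStar ^ m / 2 ^ (2 * m) := by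
  have := LamStar_pos
  rw [pow_mul, kap, Real.sq_sqrt (by positivity), div_pow, pow_mul]
  norm_num

theorem rpow_add_one_div_two {x : ℝ} (hx : 0 < x) {p : ℕ} (hp : 1 ≤ p) :
    x ^ (((p : ℝ) + 1) / 2) = √x ^ (p - 1) * x := by
  rw [show ((p : ℝ) + 1) / 2 = (p - 1 : ℕ) / 2 + 1 by rw [Nat.cast_pred hp]; ring,
    Real.rpow_add_one hx.ne', Real.rpow_div_two_eq_sqrt _ hx.le, Real.rpow_natCast]

theorem remainderBound_le_closedBound {p m : ℕ} (hp : 1 ≤ p) (hm : 1 ≤ m) {C M : ℝ} (hM : 0 ≤ M)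
    (hC : scaledMoment m ≤ C * (Real.pi * m * LamStar ^ m)) :
    remainderBound p m M ≤ closedBound p m C M := by
  have : (0 : ℝ) < m := Nat.cast_pos.2 hm
  rw [remainderBound, closedBound, rpow_add_one_div_two (by positivity) hp, mul_pow, mul_pow,
    kap_pow_two_mul]
  calc M / 2 ^ (2 * m) * ∑ α ∈ ofDegree p (2 * m), 1 / (∏ r, ((α r + 1).factorial : ℝ)) *
          ∑ j ∈ upTo p m, |gamVec m j| * ∏ r, (j r : ℝ) ^ (α r + 1)
      ≤ M / 2 ^ (2 * m) * ((p : ℝ) ^ (2 * m) * (√(Real.pi * m) ^ (p - 1) *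
          ((m : ℝ) ^ (2 * m) * scaledMoment m)) / ((2 * m + 1).factorial : ℝ)) := by
        gcongr
        exact sum_remainder_weights_le hm
    _ ≤ M / 2 ^ (2 * m) * ((p : ℝ) ^ (2 * m) * (√(Real.pi * m) ^ (p - 1) *
          ((m : ℝ) ^ (2 * m) * (C * (Real.pi * m * LamStar ^ m)))) /
            ((2 * m + 1).factorial : ℝ)) := by gcongr
    _ = M * (C * (√(Real.pi * m) ^ (p - 1) * (Real.pi * m)) / ((2 * m + 1).factorial : ℝ)) *
          (LamStar ^ m / 2 ^ (2 * m) * (p : ℝ) ^ (2 * m) * (m : ℝ) ^ (2 * m)) := by ring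

end AltSum

open AltSum in
theorem theorem2p1 (p m : ℕ) (hp : 1 ≤ p) (hm : 1 ≤ m) (n : Fin p → ℕ)
    (f : (Fin p → ℝ) → ℝ) (hf : ContDiff ℝ ((2 * m : ℕ) : WithTop ℕ∞) f) :
    -- the summation formula
    (∑ k ∈ below n, f (fun r => (k r : ℝ)) = approx m n f - remainder m n f) ∧
    -- the five other forms of the approximation
    (approx m n f = ∑ j ∈ upTo p m, gamVec m j * ∑ i ∈ below j,
      boxInt (fun r => -1 + (j r : ℝ) / 2 - (i r : ℝ))
        (fun r => (n r : ℝ) - 1 + (j r : ℝ) / 2 - (i r : ℝ)) f) ∧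
    (approx m n f = ∑ β ∈ symBox p m, tauVec m (1 + absVec β) *
      boxInt (fun r => (β r : ℝ) / 2 - 1 / 2) (fun r => (n r : ℝ) - 1 / 2 - (β r : ℝ) / 2) f) ∧
    (approx m n f = ∑ β ∈ symBox p m, tauVec m (1 + absVec β) *
      boxInt (fun r => -1 / 2 - (β r : ℝ) / 2) (fun r => (n r : ℝ) - 1 / 2 - (β r : ℝ) / 2) f) ∧
    (approx m n f = ∑ α ∈ below (fun _ : Fin p => m), tauVec m (1 + α) * ∑ β ∈ signed α,
      boxInt (fun r => (β r : ℝ) / 2 - 1 / 2) (fun r => (n r : ℝ) - 1 / 2 - (β r : ℝ) / 2) f) ∧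
    (approx m n f = ∑ α ∈ below (fun _ : Fin p => m), tauVec m (1 + α) * ∑ β ∈ signed α,
      boxInt (fun r => -1 / 2 - (β r : ℝ) / 2) (fun r => (n r : ℝ) - 1 / 2 - (β r : ℝ) / 2) f) ∧
    -- the series form of the coefficients `τ`
    (∀ j : ℕ, 1 ≤ j → j ≤ m → HasSum (fun β : ℕ => gam m (j + 2 * β)) (tau m j)) ∧
    -- the coefficients in each form sum to one
    (∑ j ∈ upTo p m, gamVec m j * ∑ _i ∈ below j, (1 : ℝ) = 1) ∧
    (∑ j ∈ upTo p m, gamVec m j * ∏ r, (j r : ℝ) = 1) ∧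
    (∑ β ∈ symBox p m, tauVec m (1 + absVec β) = 1) ∧
    (∑ α ∈ below (fun _ : Fin p => m), tauVec m (1 + α) * ∑ _β ∈ signed α, (1 : ℝ) = 1) ∧
    -- the bounds on the remainder
    (∀ M : ℝ,
      (∀ α : Fin p → ℕ, ∑ r, α r = 2 * m →
        ∀ u : Fin p → ℝ, (∀ r, -(m : ℝ) / 2 < u r ∧ u r ≤ (m : ℝ) / 2) →
          |∑ k ∈ below n, multiDeriv α f (fun r => (k r : ℝ) + u r)| ≤ M) →
      |remainder m n f| ≤ remainderBound p m M ∧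
      remainderBound p m M ≤ closedBound p m 1.0331 M ∧
      (2 ≤ m → remainderBound p m M ≤ closedBound p m 1.001 M)) ∧
    -- the constants
    IsGreatest (Lam '' Set.Ioo 0 1) LamStar ∧
    (0.3081 ≤ LamStar ∧ LamStar < 0.3082) ∧
    (0.27754 ≤ kap ∧ kap < 0.27755) := by
  have hint := hf.continuous.locallyIntegrable (μ := MeasureTheory.volume)
  refine ⟨sum_eq_approx_sub_remainder n hm hf, approx_eq_sum_reflect m n hint,
    approx_eq_sum_tauVec m n f, approx_eq_sum_tauVec_reflect m n hint,
    (approx_eq_sum_tauVec m n f).trans (sum_below_mul_sum_signed hm _).symm,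
    (approx_eq_sum_tauVec_reflect m n hint).trans (sum_below_mul_sum_signed hm _).symm,
    fun j _ _ => hasSum_tau m j, sum_gamVec_mul_sum_one hm, sum_gamVec_mul_prod_self hm,
    sum_tauVec hm, sum_signed_one hm, fun M hM => ?_, isGreatest_LamStar,
    ⟨by linarith [lt_LamStar], by linarith [LamStar_lt]⟩, lt_kap.le, kap_lt⟩
  have : (0 : ℝ) < m := Nat.cast_pos.2 hm
  have hM0 : 0 ≤ M := (abs_nonneg _).trans <|
    hM (Pi.single ⟨0, hp⟩ (2 * m)) (by simp) 0 fun r => by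
      rw [Pi.zero_apply]
      constructor <;> linarith
  exact ⟨abs_remainder_le hm n hf hM,
    remainderBound_le_closedBound hp hm hM0 (scaledMoment_le_mul hm), fun h2 =>
    remainderBound_le_closedBound hp hm hM0 (scaledMoment_le_mul_of_two_le h2 (by norm_num))⟩
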